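/- Theorem (compactness for weak $\Sigma$-convergence along a flow). Setting. Let $d\in\mathbb N$, $T>0$. (1) Let $\mathcal A$ be an algebra with mean value on $\mathbb R$: a norm-closed subalgebra of the algebra $\mathrm{BUC}(\mathbb R)$ of bounded uniformly continuous functions $\mathbb R\to\mathbb C$, closed under complex conjugation, containing the constants, invariant under all translations $f\mapsto f(\cdot-a)$, $a\in\mathbb R$, and such that every $f\in\mathcal A$ has a mean value $M(f)\in\mathbb C$, i.e. $f(\cdot/\varepsilon)\rightharpoonup M(f)$ weakly-$*$ in $L^\infty(\mathbb R)$ as $\varepsilon\to0$. Let $\Delta(\mathcal A)$ be the spectrum of $\mathcal A$ (the compact Hausdorff space of unital characters $s:\mathcal A\to\mathbb C$ with the weak-$*$ topology), let $\widehat f(s)=s(f)$ be the Gelfand transform, and let $\beta$ be the Radon probability measure on $\Delta(\mathcal A)$ with $M(f)=\int_{\Delta(\mathcal A)}\widehat f\,d\beta$ for all $f\in\mathcal A$. Let $\mathbb T^d=\mathbb R^d/\mathbb Z^d$ with its normalized Lebesgue measure, and let $\mathcal A\odot C(\mathbb T^d)$ be the closure, in the supremum norm on $\mathbb R\times\mathbb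 T^d$, of the linear span of the products $f(\tau)g(y)$ with $f\in\mathcal A$, $g\in C(\mathbb T^d)$. For $F\in\mathcal A\odot C(\mathbb T^d)$ put $\widehat F(s,y)=s(F(\cdot,y))$. (2) Let $\Phi:\mathbb R\times\mathbb R^d\to\mathbb R^d$, $(\tau,x)\mapsto\Phi_\tau(x)$, be of class $C^1$ with $\Phi_t(\Phi_s(x))=\Phi_{t+s}(x)$ for all $t,s,x$. Let $J(\tau,x)$ be the Jacobian matrix at $x$ of $\Phi_{-\tau}$, and assume that $\det J(\tau,x)=1$ for all $\tau,x$ and that $\sup_{x\in K}\sup_{\tau\in\mathbb R}|J(\tau,x)|<\infty$ for every compact $K\subset\mathbb R^d$. (3) A test function is a map $\psi:(0,T)\times\mathbb R^d\to\mathcal A\odot C(\mathbb T^d)$ that is $C^\infty$ as a map into this Banach space and whose norm is square-integrable on $(0,T)\times\mathbb R^d$; write $\psi(t,X,\tau,y)$ for the value of $\psi(t,X)$ at $(\tau,y)$, regarded as $\mathbb Z^d$-periodic in $y$. Given positive $\varepsilon_n\to0$, a sequence $u^{\varepsilon_n}\in L^2((0,T)\times\mathbb R^d)$ weakly $\Sigma$-converges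 along $\Phi_\tau$ to $u_0\in L^2((0,T)\times\mathbb R^d\times\Delta(\mathcal A)\times\mathbb T^d)$ (with respect to the measure $dt\,dX\,d\beta(s)\,dy$) if for every test function $\psi$ $$\lim_{n\to\infty}\iint_{(0,T)\times\mathbb R^d}u^{\varepsilon_n}(t,x)\,\psi\Big(t,\Phi_{-t/\varepsilon_n}(x),\frac t{\varepsilon_n},\frac x{\varepsilon_n}\Big)\,dx\,dt=\iiiint_{(0,T)\times\mathbb R^d\times\Delta(\mathcal A)\times\mathbb T^d}u_0(t,X,s,y)\,\widehat\psi(t,X,s,y)\,dy\,d\beta(s)\,dX\,dt .$$ Claim. Let $\varepsilon_n>0$, $\varepsilon_n\to0$, and let $(u^{\varepsilon_n})_{n\in\mathbb N}$ be a bounded sequence of complex-valued functions in $L^2((0,T)\times\mathbb R^d)$. Then there are a subsequence $(\varepsilon_{n_k})_k$ and a function $u_0\in L^2((0,T)\times\mathbb R^d\times\Delta(\mathcal A)\times\mathbb T^d)$ such that $u^{\varepsilon_{n_k}}$ weakly $\Sigma$-converges along $\Phi_\tau$ to $u_0$ as $k\to\infty$. -/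

import Mathlib

open MeasureTheory Filter Topology Set
open scoped BoundedContinuousFunction ContDiff

noncomputable section

/-- `HasMeanValue f m`: the functions `f (· / ε)` converge to the constant `m` weakly-* in
`L^∞(ℝ)` as `ε → 0`, that is, when tested against every `g ∈ L¹(ℝ)`. -/
def HasMeanValue (f : ℝ → ℂ) (m : ℂ) : Prop :=
  ∀ g : ℝ → ℂ, Integrable g volume →
    Tendsto (fun ε : ℝ => ∫ t, f (t / ε) * g t) (𝓝[>] 0) (𝓝 (∫ t, m * g t))

/-- An algebra with mean value: a closed, conjugation-invariant subalgebra of `BUC(ℝ)` containing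
the constants (both are built into `StarSubalgebra ℂ`), invariant under translations, each of
whose elements has a mean value. -/
structure AlgebraWithMeanValue where
  toStarSubalgebra : StarSubalgebra ℂ (ℝ →ᵇ ℂ)
  isClosed' : IsClosed (toStarSubalgebra : Set (ℝ →ᵇ ℂ))
  uniformContinuous' : ∀ f ∈ toStarSubalgebra, UniformContinuous f
  translate_mem' : ∀ f ∈ toStarSubalgebra, ∀ a : ℝ,
    f.compContinuous ⟨fun t : ℝ => t - a, by fun_prop⟩ ∈ toStarSubalgebra
  exists_mean' : ∀ f ∈ toStarSubalgebra, ∃ m : ℂ, HasMeanValue f m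

namespace AlgebraWithMeanValue

variable (A : AlgebraWithMeanValue)

/-- The algebra as a type; it is a commutative unital C⋆-algebra with the supremum norm. -/
abbrev Alg : Type := A.toStarSubalgebra

instance : IsClosed (A.toStarSubalgebra : Set (ℝ →ᵇ ℂ)) := A.isClosed'

/-- The spectrum `Δ(A)`: the characters of `A`, with the weak-* topology. -/
abbrev Spectrum : Type := WeakDual.characterSpace ℂ A.Alg

instance : MeasurableSpace A.Spectrum := borel _

instance : BorelSpace A.Spectrum := ⟨rfl⟩

/-- The mean value `M(f)`. -/
def mean (f : A.Alg) : ℂ := Classical.choose (A.exists_mean' f.1 f.2)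

theorem hasMeanValue_mean (f : A.Alg) : HasMeanValue f.1 (A.mean f) :=
  Classical.choose_spec (A.exists_mean' f.1 f.2)

end AlgebraWithMeanValue

theorem HasMeanValue.tendsto {f : ℝ → ℂ} {m : ℂ} (h : HasMeanValue f m) :
    Tendsto (fun ε : ℝ => ∫ t in Icc (0 : ℝ) 1, f (t / ε)) (𝓝[>] 0) (𝓝 m) := by
  have hg : Integrable (indicator (Icc (0 : ℝ) 1) (fun _ => (1 : ℂ))) volume := by
    rw [integrable_indicator_iff measurableSet_Icc]
    exact integrableOn_const (by simp)
  have key : ∀ φ : ℝ → ℂ, (∫ t, φ t * indicator (Icc (0 : ℝ) 1) (fun _ => (1 : ℂ)) t)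
      = ∫ t in Icc (0 : ℝ) 1, φ t := by
    intro φ
    rw [← integral_indicator measurableSet_Icc]
    congr 1
    ext t
    by_cases ht : t ∈ Icc (0 : ℝ) 1 <;> simp [ht]
  have := h _ hg
  rw [key (fun _ => m)] at this
  simpa [key] using this

namespace AlgebraWithMeanValue

variable (A : AlgebraWithMeanValue)

theorem integrableOn_rescale (f : A.Alg) (ε : ℝ) :
    IntegrableOn (fun t : ℝ => f.1 (t / ε)) (Icc (0 : ℝ) 1) volume :=
  (f.1.continuous.comp (by fun_prop)).continuousOn.integrableOn_compact isCompact_Icc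

theorem mean_add (f g : A.Alg) : A.mean (f + g) = A.mean f + A.mean g := by
  refine tendsto_nhds_unique (A.hasMeanValue_mean (f + g)).tendsto ?_
  refine ((A.hasMeanValue_mean f).tendsto.add (A.hasMeanValue_mean g).tendsto).congr fun ε => ?_
  rw [← integral_add (A.integrableOn_rescale f ε) (A.integrableOn_rescale g ε)]
  rfl

theorem mean_smul (c : ℂ) (f : A.Alg) : A.mean (c • f) = c * A.mean f := by
  refine tendsto_nhds_unique (A.hasMeanValue_mean (c • f)).tendsto ?_
  refine ((A.hasMeanValue_mean f).tendsto.const_mul c).congr fun ε => ?_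
  rw [← integral_const_mul]
  rfl

theorem mean_one : A.mean 1 = 1 := by
  refine tendsto_nhds_unique (A.hasMeanValue_mean 1).tendsto ?_
  have h : ∀ ε : ℝ, (∫ t in Icc (0 : ℝ) 1, (1 : A.Alg).1 (t / ε)) = 1 := by
    intro ε
    simp
  simp only [h]
  exact tendsto_const_nhds

theorem mean_star_mul_self_nonneg (f : A.Alg) : 0 ≤ (A.mean (star f * f)).re := by
  refine ge_of_tendsto' (Complex.continuous_re.continuousAt.tendsto.comp
    (A.hasMeanValue_mean (star f * f)).tendsto) fun ε => ?_
  have h : ∀ x : ℝ, (star f * f).1 x = ((‖f.1 x‖ ^ 2 : ℝ) : ℂ) := by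
    intro x
    change (starRingEnd ℂ) (f.1 x) * f.1 x = _
    rw [mul_comm, Complex.mul_conj']
    simp
  simp only [h, Function.comp_apply]
  rw [integral_complex_ofReal, Complex.ofReal_re]
  exact integral_nonneg fun x => by positivity

/-- A real continuous function on the spectrum, regarded as a complex one. -/
def toComplexFun (g : CompactlySupportedContinuousMap A.Spectrum ℝ) : C(A.Spectrum, ℂ) :=
  ⟨fun s => (g s : ℂ), by fun_prop⟩

/-- The mean value transported to `C(Δ(A), ℝ)` by the Gelfand isomorphism `A ≃ C(Δ(A))`; it is a
positive linear functional. -/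
def spectralMean : CompactlySupportedContinuousMap A.Spectrum ℝ →ₚ[ℝ] ℝ :=
  PositiveLinearMap.mk₀
    { toFun := fun g => (A.mean ((gelfandStarTransform A.Alg).symm (A.toComplexFun g))).re
      map_add' := by
        intro f g
        have : A.toComplexFun (f + g) = A.toComplexFun f + A.toComplexFun g := by
          ext s; simp [toComplexFun]
        rw [this, map_add, mean_add, Complex.add_re]
      map_smul' := by
        intro c g
        have : A.toComplexFun (c • g) = (c : ℂ) • A.toComplexFun g := by
          ext s; simp [toComplexFun]
        rw [this, map_smul, mean_smul, Complex.re_ofReal_mul]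
        rfl }
    (by
      intro g hg
      let h : C(A.Spectrum, ℂ) := ⟨fun s => (Real.sqrt (g s) : ℂ), by fun_prop⟩
      have hh : A.toComplexFun g = star h * h := by
        ext s
        have hs : 0 ≤ g s := hg s
        change (g s : ℂ) = (starRingEnd ℂ) (Real.sqrt (g s) : ℂ) * (Real.sqrt (g s) : ℂ)
        rw [Complex.conj_ofReal, ← Complex.ofReal_mul, Real.mul_self_sqrt hs]
      change 0 ≤ (A.mean ((gelfandStarTransform A.Alg).symm (A.toComplexFun g))).re
      rw [hh, map_mul, map_star]
      exact A.mean_star_mul_self_nonneg _)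

/-- The measure `β` on `Δ(A)` that represents the mean value (Riesz representation). -/
def meanMeasure : Measure A.Spectrum := RealRMK.rieszMeasure A.spectralMean

theorem re_integral_meanMeasure (g : CompactlySupportedContinuousMap A.Spectrum ℝ) :
    ∫ s, g s ∂A.meanMeasure
      = (A.mean ((gelfandStarTransform A.Alg).symm (A.toComplexFun g))).re :=
  RealRMK.integral_rieszMeasure A.spectralMean g

instance : IsFiniteMeasure A.meanMeasure := by
  unfold meanMeasure; infer_instance

instance : A.meanMeasure.Regular := by
  unfold meanMeasure; infer_instance

/-- The measure `β` represents the mean value: `M(f) = ∫ f̂ dβ`. -/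
theorem mean_eq_integral (f : A.Alg) :
    A.mean f = ∫ s, WeakDual.gelfandTransform ℂ A.Alg f s ∂A.meanMeasure := by
  let G := gelfandStarTransform A.Alg
  let r : CompactlySupportedContinuousMap A.Spectrum ℝ :=
    CompactlySupportedContinuousMap.continuousMapEquiv ⟨fun s => (G f s).re, by fun_prop⟩
  let i : CompactlySupportedContinuousMap A.Spectrum ℝ :=
    CompactlySupportedContinuousMap.continuousMapEquiv ⟨fun s => (G f s).im, by fun_prop⟩
  have hint : Integrable (fun s => G f s) A.meanMeasure :=
    (G f).continuous.integrable_of_hasCompactSupport (HasCompactSupport.of_compactSpace _)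
  have hreal : ∀ g : CompactlySupportedContinuousMap A.Spectrum ℝ,
      (A.mean (G.symm (A.toComplexFun g))).im = 0 := by
    intro g
    have hsa : star (G.symm (A.toComplexFun g)) = G.symm (A.toComplexFun g) := by
      rw [← map_star]
      congr 1
      ext s
      exact Complex.conj_ofReal _
    have hval : ∀ x : ℝ, ((G.symm (A.toComplexFun g)).1 x).im = 0 := fun x =>
      Complex.conj_eq_iff_im.1 (congrArg (fun h : A.Alg => h.1 x) hsa)
    refine tendsto_nhds_unique (Complex.continuous_im.continuousAt.tendsto.comp
      (A.hasMeanValue_mean _).tendsto) ?_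
    refine tendsto_const_nhds.congr fun ε => ?_
    have := integral_im (𝕜 := ℂ) (A.integrableOn_rescale (G.symm (A.toComplexFun g)) ε)
    simp only [RCLike.im_eq_complex_im, hval, integral_zero] at this
    exact this
  have hf : f = G.symm (A.toComplexFun r) + Complex.I • G.symm (A.toComplexFun i) := by
    apply EquivLike.injective G
    rw [map_add, map_smul, G.apply_symm_apply, G.apply_symm_apply]
    ext s
    change G f s = ((G f s).re : ℂ) + Complex.I * ((G f s).im : ℂ)
    rw [mul_comm, Complex.re_add_im]
  have h1 : ∫ s, (G f s).re ∂A.meanMeasure = (∫ s, G f s ∂A.meanMeasure).re := integral_re hint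
  have h2 : ∫ s, (G f s).im ∂A.meanMeasure = (∫ s, G f s ∂A.meanMeasure).im := integral_im hint
  have hr : ∫ s, (G f s).re ∂A.meanMeasure = (A.mean (G.symm (A.toComplexFun r))).re :=
    A.re_integral_meanMeasure r
  have hi : ∫ s, (G f s).im ∂A.meanMeasure = (A.mean (G.symm (A.toComplexFun i))).re :=
    A.re_integral_meanMeasure i
  change A.mean f = ∫ s, G f s ∂A.meanMeasure
  have hm : A.mean f = A.mean (G.symm (A.toComplexFun r))
      + Complex.I * A.mean (G.symm (A.toComplexFun i)) := by
    conv_lhs => rw [hf]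
    rw [mean_add, mean_smul]
  rw [hm]
  apply Complex.ext
  · simp [hreal, ← hr, h1]
  · simp [hreal, ← hi, h2]

instance : IsProbabilityMeasure A.meanMeasure := by
  have h := A.mean_eq_integral 1
  rw [mean_one, map_one] at h
  have h2 : A.meanMeasure.real univ = 1 := by
    have : (1 : ℂ) = (A.meanMeasure.real univ : ℂ) := by simpa using h
    exact_mod_cast this.symm
  exact ⟨by simpa [Measure.real, ENNReal.toReal_eq_one_iff] using h2⟩

/-- The torus `𝕋^d = ℝ^d / ℤ^d`; its `volume` is the product Haar probability measure. -/
abbrev Torus (d : ℕ) : Type := UnitAddTorus (Fin d)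

/-- The product algebra `A ⊙ C(𝕋^d)`: the uniform closure, among bounded continuous functions of
`(τ, y) ∈ ℝ × 𝕋^d`, of the span of the products `f(τ) g(y)` with `f ∈ A`, `g ∈ C(𝕋^d)`. -/
def productAlgebra (d : ℕ) : Submodule ℂ ((ℝ × Torus d) →ᵇ ℂ) :=
  (Submodule.span ℂ {F : (ℝ × Torus d) →ᵇ ℂ | ∃ f : A.Alg, ∃ g : C(Torus d, ℂ),
    ∀ (τ : ℝ) (y : Torus d), F (τ, y) = f.1 τ * g y}).topologicalClosure

variable {d : ℕ}

/-- The slice `F(·, y)` of a bounded continuous function on `ℝ × 𝕋^d`. -/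
def slice (F : (ℝ × Torus d) →ᵇ ℂ) (y : Torus d) : ℝ →ᵇ ℂ :=
  F.compContinuous ⟨fun τ : ℝ => (τ, y), by fun_prop⟩

theorem slice_mem (F : A.productAlgebra d) (y : Torus d) :
    slice F.1 y ∈ A.toStarSubalgebra := by
  let L : ((ℝ × Torus d) →ᵇ ℂ) →ₗ[ℂ] (ℝ →ᵇ ℂ) :=
    { toFun := fun F => slice F y
      map_add' := fun _ _ => rfl
      map_smul' := fun _ _ => rfl }
  have hL : Continuous L := BoundedContinuousFunction.continuous_compContinuous _
  let S : Submodule ℂ (ℝ →ᵇ ℂ) := Subalgebra.toSubmodule A.toStarSubalgebra.toSubalgebra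
  have hS : IsClosed ((S.comap L : Submodule ℂ _) : Set ((ℝ × Torus d) →ᵇ ℂ)) :=
    A.isClosed'.preimage hL
  refine Submodule.topologicalClosure_minimal _ (Submodule.span_le.2 ?_) hS F.2
  rintro G ⟨f, g, hG⟩
  have : L G = (g y • f : A.Alg).1 := by
    ext τ
    exact (hG τ y).trans (mul_comm _ _)
  change L G ∈ A.toStarSubalgebra
  rw [this]
  exact (g y • f : A.Alg).2

/-- The Gelfand transform in the variable `τ`: `F̂(s, y) = s(F(·, y))`. -/
def gelfandHat (F : A.productAlgebra d) (p : A.Spectrum × Torus d) : ℂ :=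
  WeakDual.gelfandTransform ℂ A.Alg ⟨slice F.1 p.2, A.slice_mem F p.2⟩ p.1

end AlgebraWithMeanValue

/-- The space `ℝ^d` with the Euclidean norm. -/
abbrev Space (d : ℕ) : Type := EuclideanSpace ℝ (Fin d)

/-- The class in `𝕋^d` of a point of `ℝ^d`. -/
def toTorus {d : ℕ} (x : Space d) : UnitAddTorus (Fin d) := fun i => (x i : UnitAddCircle)

/-- The Jacobian `J(τ, x)`: by convention the derivative in `x` of the backward map `Φ_{-τ}`. -/
def flowJacobian {d : ℕ} (Φ : ℝ → Space d → Space d) (τ : ℝ) (x : Space d) :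
    Space d →L[ℝ] Space d :=
  fderiv ℝ (Φ (-τ)) x

/-- The standing assumptions on the flow `Φ_τ(x)`. -/
structure IsAdmissibleFlow {d : ℕ} (Φ : ℝ → Space d → Space d) : Prop where
  contDiff : ContDiff ℝ 1 (fun p : ℝ × Space d => Φ p.1 p.2)
  group : ∀ (t s : ℝ) (x : Space d), Φ t (Φ s x) = Φ (t + s) x
  jacobian_bounded : ∀ K : Set (Space d), IsCompact K →
    ∃ C : ℝ, ∀ x ∈ K, ∀ τ : ℝ, ‖flowJacobian Φ τ x‖ ≤ C
  volume_preserving : ∀ (τ : ℝ) (x : Space d), (flowJacobian Φ τ x).det = 1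

/-- Lebesgue measure on `(0,T) × ℝ^d`. -/
def spaceTimeMeasure (d : ℕ) (T : ℝ) : Measure (ℝ × Space d) :=
  volume.restrict (Ioo 0 T ×ˢ univ)

/-- The measure `dt dX dβ(s) dy` on `(0,T) × ℝ^d × Δ(A) × 𝕋^d`. -/
def limitMeasure (A : AlgebraWithMeanValue) (d : ℕ) (T : ℝ) :
    Measure ((ℝ × Space d) × (A.Spectrum × UnitAddTorus (Fin d))) :=
  (spaceTimeMeasure d T).prod (A.meanMeasure.prod volume)

/-- Test functions `ψ(t, X, τ, y)`: smooth functions of `(t, X) ∈ (0,T) × ℝ^d` with values in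
`A ⊙ C(𝕋^d)` and square-integrable norm. This includes all the smooth ones with compact
support in `(0,T) × ℝ^d` or in `[0,T] × ℝ^d`. -/
structure IsTestFunction (A : AlgebraWithMeanValue) {d : ℕ} (T : ℝ)
    (ψ : ℝ × Space d → A.productAlgebra d) : Prop where
  smooth : ContDiffOn ℝ ∞ ψ (Ioo 0 T ×ˢ univ)
  memLp : MemLp ψ 2 (spaceTimeMeasure d T)

/-- Weak `Σ`-convergence along the flow `Φ` of the sequence `u n`, attached to the parameters
`ε n`, to the limit `u₀`. -/
def WeaklySigmaConverges (A : AlgebraWithMeanValue) {d : ℕ} (T : ℝ) (Φ : ℝ → Space d → Space d)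
    (ε : ℕ → ℝ) (u : ℕ → Lp ℂ 2 (spaceTimeMeasure d T)) (u₀ : Lp ℂ 2 (limitMeasure A d T)) :
    Prop :=
  ∀ ψ : ℝ × Space d → A.productAlgebra d, IsTestFunction A T ψ →
    Tendsto
      (fun n => ∫ p, u n p * (ψ (p.1, Φ (-p.1 / ε n) p.2)).1
        (p.1 / ε n, toTorus ((ε n)⁻¹ • p.2)) ∂spaceTimeMeasure d T)
      atTop
      (𝓝 (∫ q, u₀ q * A.gelfandHat (ψ q.1) q.2 ∂limitMeasure A d T))

end

/-!
Pairing `u^{ε_n}` with the traces `ψ(t, Φ_{-t/ε}(x), t/ε, x/ε)` gives functionals of `ψ` whose size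
is controlled by the `L²` norm of the trace, so compactness rests on the mean value property
`‖trace_ε ψ‖ → ‖ψ̂‖`. Applied to `|ψ|²`, this follows from the convergence of `∫ trace_ε w` to
`∫ ŵ` for all `w ∈ L¹(A ⊙ C(𝕋^d))`, and by density it is enough to take `w = g(t, X) f(τ) e_k(y)`
with a character `e_k` of the torus. For `k = 0` the measure preserving change of variables
`X = Φ_{-t/ε}(x)` removes the flow and leaves the mean value of `f`. For `k ≠ 0` a shift of `x` by
half a period of `e_k(x/ε)` changes the sign of the character but changes `g(t, Φ_{-t/ε}(x))` only
by `O(ε)`, because the derivatives of the flow are bounded on the support of `g`, uniformly in time.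

The spectrum of `A` need not be metrizable, so `L²(A ⊙ C(𝕋^d))` need not be separable and a diagonal
argument is not available. Instead the subsequence is chosen by a variational argument: a `ψ` which
almost maximizes `2 Re a - ‖ψ̂‖²` over the cluster points `a` of the functionals at `ψ` almost
represents the limit functional, and such `ψ̂` along shrinking filters form a Cauchy sequence.
-/

section WeakCompactness

theorem mapClusterPt_prodMk_of_tendsto {ι Y Z : Type*} [TopologicalSpace Y] [TopologicalSpace Z]
    {F : Filter ι} {u : ι → Y} {v : ι → Z} {a : Y} {b : Z} (hu : Tendsto u F (𝓝 a))
    (hv : MapClusterPt b F v) : MapClusterPt (a, b) F fun i => (u i, v i) := by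
  rw [((𝓝 a).basis_sets.prod_nhds (𝓝 b).basis_sets).mapClusterPt_iff_frequently]
  rintro ⟨s, t⟩ ⟨hs, ht⟩
  exact ((hv.frequently ht).and_eventually (hu hs)).mono fun i hi => ⟨hi.2, hi.1⟩

theorem norm_le_mul_of_forall_re_mul_le {𝕜 : Type*} [RCLike 𝕜] {z : 𝕜} {δ N : ℝ}
    (hδ : 0 ≤ δ) (hN : 0 ≤ N)
    (h : ∀ t : 𝕜, 2 * RCLike.re (t * z) ≤ δ ^ 2 + ‖t‖ ^ 2 * N ^ 2) : ‖z‖ ≤ δ * N := by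
  have hquad : ∀ s : ℝ, 0 ≤ ‖z‖ ^ 2 * N ^ 2 * (s * s) + -2 * ‖z‖ ^ 2 * s + δ ^ 2 := fun s => by
    have hs := h (s * starRingEnd 𝕜 z)
    have hre : RCLike.re ((s : 𝕜) * starRingEnd 𝕜 z * z) = s * ‖z‖ ^ 2 := by
      rw [mul_assoc, RCLike.conj_mul, ← RCLike.ofReal_pow, ← RCLike.ofReal_mul, RCLike.ofReal_re]
    rw [hre, norm_mul, RCLike.norm_conj, RCLike.norm_ofReal, mul_pow, sq_abs] at hs
    linarith
  have hdiscr := discrim_le_zero hquad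
  rw [discrim] at hdiscr
  rcases (norm_nonneg z).eq_or_lt with hz | hz
  · rw [← hz]; positivity
  · refine le_of_sq_le_sq ?_ (by positivity)
    nlinarith [pow_pos hz 2]

variable {ι 𝕜 X H : Type*} [RCLike 𝕜] [AddCommGroup X] [Module 𝕜 X] [NormedAddCommGroup H]
  [InnerProductSpace 𝕜 H]

theorem norm_le_of_norm_inner_self_le {z : H} {c : ℝ} (hc : 0 ≤ c)
    (h : ‖inner 𝕜 z z‖ ≤ c * ‖z‖) : ‖z‖ ≤ c := by
  rw [inner_self_eq_norm_sq_to_K, norm_pow, RCLike.norm_ofReal, abs_norm, sq] at h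
  rcases (norm_nonneg z).eq_or_lt with hz | hz
  · rwa [← hz]
  · exact le_of_mul_le_mul_right h hz

/-- The functionals `l i` are dominated, asymptotically along the filter `F`, by `C` times the
seminorm `x ↦ ‖R x‖`. -/
def IsAsymptoticallyDominated (F : Filter ι) (l : ι → X →ₗ[𝕜] 𝕜) (R : X →ₗ[𝕜] H) (C : ℝ) : Prop :=
  ∀ (x : X) (c : ℝ), C * ‖R x‖ < c → ∀ᶠ i in F, ‖l i x‖ ≤ c

namespace IsAsymptoticallyDominated

variable {F G : Filter ι} {l : ι → X →ₗ[𝕜] 𝕜} {R : X →ₗ[𝕜] H} {C : ℝ}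

theorem mono (h : IsAsymptoticallyDominated F l R C) (hGF : G ≤ F) :
    IsAsymptoticallyDominated G l R C :=
  fun x c hc => (h x c hc).filter_mono hGF

theorem norm_le_of_mapClusterPt (h : IsAsymptoticallyDominated F l R C) {x : X} {a : 𝕜}
    (ha : MapClusterPt a F fun i => l i x) : ‖a‖ ≤ C * ‖R x‖ := by
  refine le_of_forall_gt_imp_ge_of_dense fun c hc => ?_
  have hball := (Metric.isClosed_closedBall (x := (0 : 𝕜)) (ε := c)).mem_of_mapClusterPt ha
    ((h x c hc).mono fun i hi => mem_closedBall_zero_iff.2 hi)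
  exact mem_closedBall_zero_iff.1 hball

theorem exists_mapClusterPt [F.NeBot] (h : IsAsymptoticallyDominated F l R C) (x : X) :
    ∃ a, MapClusterPt a F fun i => l i x := by
  obtain ⟨a, -, ha⟩ := (isCompact_closedBall (0 : 𝕜) (C * ‖R x‖ + 1)).exists_mapClusterPt
    (f := F) (u := fun i => l i x)
    (le_principal_iff.2 ((h x _ (lt_add_one _)).mono fun i hi => mem_closedBall_zero_iff.2 hi))
  exact ⟨a, ha⟩

theorem tendsto_of_forall_mapClusterPt_eq (h : IsAsymptoticallyDominated F l R C) {x : X} {a : 𝕜}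
    (ha : ∀ b, (MapClusterPt b F fun i => l i x) → b = a) : Tendsto (fun i => l i x) F (𝓝 a) :=
  (isCompact_closedBall (0 : 𝕜) (C * ‖R x‖ + 1)).tendsto_nhds_of_unique_mapClusterPt
    ((h x _ (lt_add_one _)).mono fun _ hi => mem_closedBall_zero_iff.2 hi) fun b _ => ha b

theorem exists_almost_maximal [F.NeBot] (h : IsAsymptoticallyDominated F l R C) {η : ℝ}
    (hη : 0 < η) : ∃ x a, (MapClusterPt a F fun i => l i x) ∧
      ∀ y b, (MapClusterPt b F fun i => l i y) →
        2 * RCLike.re b - ‖R y‖ ^ 2 ≤ 2 * RCLike.re a - ‖R x‖ ^ 2 + η := by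
  let S : Set ℝ := {r | ∃ x a, (MapClusterPt a F fun i => l i x) ∧
    2 * RCLike.re a - ‖R x‖ ^ 2 = r}
  have hne : S.Nonempty := by
    obtain ⟨a, ha⟩ := h.exists_mapClusterPt 0
    exact ⟨_, 0, a, ha, rfl⟩
  have hbdd : BddAbove S := by
    refine ⟨C ^ 2, ?_⟩
    rintro _ ⟨x, a, ha, rfl⟩
    nlinarith [RCLike.re_le_norm a, h.norm_le_of_mapClusterPt ha, sq_nonneg (C - ‖R x‖)]
  obtain ⟨_, ⟨x, a, ha, rfl⟩, hlt⟩ := exists_lt_of_lt_csSup hne (sub_lt_self (sSup S) hη)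
  exact ⟨x, a, ha, fun y b hb => by linarith [le_csSup hbdd ⟨y, b, hb, rfl⟩]⟩

/-- If `x` almost maximizes, over all cluster points `a` of `i ↦ l i x`, the concave functional
whose first variation is `a - ⟪R x, R ·⟫`, then that variation is small. -/
theorem exists_filter_norm_sub_inner_le [F.NeBot] [F.IsCountablyGenerated]
    (h : IsAsymptoticallyDominated F l R C) {δ : ℝ} (hδ : 0 < δ) :
    ∃ G ≤ F, G.NeBot ∧ G.IsCountablyGenerated ∧ ∃ x, ∀ y b, (MapClusterPt b G fun i => l i y) →
      ‖b - inner 𝕜 (R x) (R y)‖ ≤ δ * ‖R y‖ := by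
  obtain ⟨x, a, ha, hmax⟩ := h.exists_almost_maximal (pow_pos hδ 2)
  have hne : (F ⊓ comap (fun i => l i x) (𝓝 a)).NeBot := by
    rw [← map_neBot_iff fun i => l i x, Filter.push_pull, inf_comm]
    exact ha
  refine ⟨F ⊓ comap (fun i => l i x) (𝓝 a), inf_le_left, hne, inferInstance, x, fun y b hb => ?_⟩
  refine norm_le_mul_of_forall_re_mul_le hδ.le (norm_nonneg _) fun t => ?_
  have hpair := mapClusterPt_prodMk_of_tendsto (tendsto_comap.mono_left inf_le_right) hb
  have hsum : MapClusterPt (a + t * b) F fun i => l i (x + t • y) := by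
    simpa [Function.comp_def] using (hpair.continuousAt_comp (f := fun p : 𝕜 × 𝕜 => p.1 + t * p.2)
      (by fun_prop)).mono inf_le_left
  have hle := hmax _ _ hsum
  rw [map_add R, norm_add_sq (𝕜 := 𝕜), map_smul, norm_smul, inner_smul_right, mul_pow,
    map_add] at hle
  rw [mul_sub, map_sub]
  linarith

theorem exists_antitone_filter_norm_sub_inner_le [F.NeBot] [F.IsCountablyGenerated]
    (h : IsAsymptoticallyDominated F l R C) :
    ∃ (Fs : ℕ → Filter ι) (x : ℕ → X), Antitone Fs ∧
      (∀ j, Fs j ≤ F ∧ (Fs j).NeBot ∧ (Fs j).IsCountablyGenerated) ∧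
      ∀ j y b, (MapClusterPt b (Fs j) fun i => l i y) →
        ‖b - inner 𝕜 (R (x j)) (R y)‖ ≤ (1 / 2) ^ j * ‖R y‖ := by
  let Sub := {G : Filter ι // G ≤ F ∧ G.NeBot ∧ G.IsCountablyGenerated}
  have hstep : ∀ (j : ℕ) (G : Sub), ∃ G' : Sub, G'.1 ≤ G.1 ∧ ∃ x, ∀ y b,
      (MapClusterPt b G'.1 fun i => l i y) →
        ‖b - inner 𝕜 (R x) (R y)‖ ≤ (1 / 2) ^ j * ‖R y‖ := by
    rintro j ⟨G, hGF, hG, hGc⟩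
    obtain ⟨G', hG'G, hG', hG'c, hx⟩ := (h.mono hGF).exists_filter_norm_sub_inner_le
      (δ := (1 / 2) ^ j) (by positivity)
    exact ⟨⟨G', hG'G.trans hGF, hG', hG'c⟩, hG'G, hx⟩
  choose next hnext x hx using hstep
  let Gs : ℕ → Sub := fun j => Nat.rec ⟨F, le_rfl, inferInstance, inferInstance⟩ next j
  exact ⟨fun j => (Gs (j + 1)).1, fun j => x j (Gs j),
    antitone_nat_of_succ_le fun j => hnext (j + 1) (Gs (j + 1)), fun j => (Gs (j + 1)).2,
    fun j => hx j (Gs j)⟩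

theorem exists_filter_tendsto_inner [CompleteSpace H] [F.NeBot] [F.IsCountablyGenerated]
    (h : IsAsymptoticallyDominated F l R C) :
    ∃ G ≤ F, G.NeBot ∧ G.IsCountablyGenerated ∧
      ∃ w : H, ∀ x, Tendsto (fun i => l i x) G (𝓝 (inner 𝕜 w (R x))) := by
  obtain ⟨Fs, x, hanti, hFs, hx⟩ := h.exists_antitone_filter_norm_sub_inner_le
  have := fun j => (hFs j).2.1
  have := fun j => (hFs j).2.2
  have hdist : ∀ j k, j ≤ k → dist (R (x j)) (R (x k)) ≤ (1 / 2) ^ j + (1 / 2) ^ k := by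
    intro j k hjk
    obtain ⟨b, hb⟩ := (h.mono (hFs k).1).exists_mapClusterPt (x j - x k)
    rw [dist_eq_norm, ← map_sub]
    refine norm_le_of_norm_inner_self_le (𝕜 := 𝕜) (by positivity) ?_
    rw [add_mul, map_sub R, inner_sub_left, ← map_sub R, norm_sub_rev,
      ← sub_sub_sub_cancel_left _ _ b]
    exact norm_sub_le_of_le (hx j _ b (hb.mono (hanti hjk))) (hx k _ b hb)
  have hpow : Tendsto (fun j : ℕ => (1 / 2 : ℝ) ^ j) atTop (𝓝 0) :=
    tendsto_pow_atTop_nhds_zero_of_lt_one (by norm_num) (by norm_num)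
  have hcauchy : CauchySeq fun j => R (x j) := by
    refine cauchySeq_of_le_tendsto_0' (fun j => (1 / 2) ^ j + (1 / 2) ^ j)
      (fun j k hjk => (hdist j k hjk).trans ?_) (by simpa using hpow.add hpow)
    gcongr _ + ?_
    exact pow_le_pow_of_le_one (by norm_num) (by norm_num) hjk
  obtain ⟨w, hw⟩ := cauchySeq_tendsto_of_complete hcauchy
  have hGF : ⨅ j, Fs j ≤ F := (iInf_le Fs 0).trans (hFs 0).1
  refine ⟨⨅ j, Fs j, hGF, iInf_neBot_of_directed' hanti.directed_ge inferInstance, inferInstance,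
    w, fun y => ?_⟩
  refine (h.mono hGF).tendsto_of_forall_mapClusterPt_eq fun b hb => ?_
  have hlim : Tendsto (fun j => inner 𝕜 (R (x j)) (R y)) atTop (𝓝 b) := by
    rw [tendsto_iff_norm_sub_tendsto_zero]
    refine squeeze_zero (fun _ => norm_nonneg _) (fun j => ?_)
      (by simpa only [zero_mul] using hpow.mul_const ‖R y‖)
    rw [norm_sub_rev]
    exact hx j y b (hb.mono (iInf_le Fs j))
  exact tendsto_nhds_unique hlim (hw.inner tendsto_const_nhds)

theorem exists_strictMono_tendsto_inner [CompleteSpace H] {l : ℕ → X →ₗ[𝕜] 𝕜}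
    (h : IsAsymptoticallyDominated atTop l R C) :
    ∃ k : ℕ → ℕ, StrictMono k ∧
      ∃ w : H, ∀ x, Tendsto (fun n => l (k n) x) atTop (𝓝 (inner 𝕜 w (R x))) := by
  obtain ⟨G, hG, _, _, w, hw⟩ := h.exists_filter_tendsto_inner
  obtain ⟨m, hm⟩ := exists_seq_tendsto G
  obtain ⟨j, hj, hmj⟩ := strictMono_subseq_of_tendsto_atTop (hm.mono_right hG)
  exact ⟨m ∘ j, hmj, w, fun x => (hw x).comp (hm.comp hj.tendsto_atTop)⟩

end IsAsymptoticallyDominated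

end WeakCompactness

section Density

variable {𝕜 P E : Type*} [RCLike 𝕜] [MeasurableSpace P] [NormedAddCommGroup E]
  [NormedSpace 𝕜 E] {μ : Measure P} {p : ENNReal} [Fact (1 ≤ p)]

variable (𝕜 p μ E) in
/-- The bilinear map `(c, g) ↦ (x ↦ g x • c)`. -/
noncomputable def smulLp : E →L[𝕜] Lp 𝕜 p μ →L[𝕜] Lp E p μ :=
  (ContinuousLinearMap.lsmul 𝕜 𝕜).flip.compLpL₂ p μ

theorem coeFn_smulLp (c : E) (g : Lp 𝕜 p μ) : smulLp 𝕜 E μ p c g =ᵐ[μ] fun x => g x • c :=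
  ContinuousLinearMap.coeFn_compLp _ _

theorem eq_top_of_smulLp_mem (hp : p ≠ ⊤) {S : Set E}
    (hS : (Submodule.span 𝕜 S).topologicalClosure = ⊤)
    {V : Submodule 𝕜 (Lp E p μ)} (hV : IsClosed (V : Set (Lp E p μ)))
    (hSV : ∀ c ∈ S, ∀ g, smulLp 𝕜 E μ p c g ∈ V) : V = ⊤ := by
  have hE : ∀ (c : E) (g : Lp 𝕜 p μ), smulLp 𝕜 E μ p c g ∈ V := by
    intro c g
    have hle : (Submodule.span 𝕜 S).topologicalClosure ≤
        V.comap ((smulLp 𝕜 E μ p).flip g).toLinearMap :=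
      Submodule.topologicalClosure_minimal _ (Submodule.span_le.2 fun c hc => hSV c hc g)
        (hV.preimage ((smulLp 𝕜 E μ p).flip g).continuous)
    exact hle (hS ▸ Submodule.mem_top : c ∈ _)
  refine Submodule.eq_top_iff'.2 fun w => ?_
  induction w using Lp.induction hp with
  | @indicatorConst c s hs hμs =>
    rw [Lp.simpleFunc.coe_indicatorConst]
    convert hE c (indicatorConstLp p hs hμs.ne 1)
    ext1
    filter_upwards [indicatorConstLp_coeFn (p := p) (hs := hs) (hμs := hμs.ne) (c := c),
      indicatorConstLp_coeFn (p := p) (hs := hs) (hμs := hμs.ne) (c := (1 : 𝕜)),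
      coeFn_smulLp c (indicatorConstLp p hs hμs.ne (1 : 𝕜))] with x h1 h2 h3
    rw [h1, h3, h2, ← indicator_smul_const_apply, one_smul]
  | add hf hg _ h1 h2 => exact V.add_mem h1 h2
  | isClosed => exact hV

end Density

section EvaluationOperator

variable {P Z E : Type*} [MeasurableSpace P] [MeasurableSpace Z] [NormedAddCommGroup E]
  [NormedSpace ℂ E] {μ : Measure P} {ν : Measure Z} {p : ENNReal}

theorem stronglyMeasurable_apply_of_forall_measurable {Λ : Z → E →L[ℂ] ℂ}
    (hm : ∀ F, Measurable fun z => Λ z F) {φ : Z → E} (hφ : StronglyMeasurable φ) :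
    StronglyMeasurable fun z => Λ z (φ z) := by
  refine stronglyMeasurable_of_tendsto atTop (f := fun n z => Λ z (hφ.approx n z))
    (fun n => ?_) ?_
  · exact ((hφ.approx n).measurable_bind (fun F z => Λ z F) hm).stronglyMeasurable
  · rw [tendsto_pi_nhds]
    exact fun z => ((Λ z).continuous.tendsto _).comp (hφ.tendsto_approx z)

/-- A family of functionals on `E` of norm at most one, indexed by `Z` and weakly measurable,
together with a measure preserving projection of `Z` onto the domain `P` of `E`-valued
functions. -/
structure EvaluationFamily (E : Type*) [NormedAddCommGroup E] [NormedSpace ℂ E] (ν : Measure Z)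
    (μ : Measure P) where
  functional : Z → E →L[ℂ] ℂ
  measurable_functional : ∀ F, Measurable fun z => functional z F
  norm_functional_le : ∀ z, ‖functional z‖ ≤ 1
  proj : Z → P
  measurePreserving_proj : MeasurePreserving proj ν μ

namespace EvaluationFamily

variable (e : EvaluationFamily E ν μ)

theorem norm_functional_apply_le (z : Z) (F : E) : ‖e.functional z F‖ ≤ ‖F‖ :=
  ((e.functional z).le_of_opNorm_le (e.norm_functional_le z) F).trans_eq (one_mul _)

theorem memLp {ψ : P → E} (hψ : MemLp ψ p μ) :
    MemLp (fun z => e.functional z (ψ (e.proj z))) p ν := by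
  have h := hψ.comp_measurePreserving e.measurePreserving_proj
  refine h.mono ?_ (Eventually.of_forall fun z => e.norm_functional_apply_le z _)
  obtain ⟨φ, hφ, hφe⟩ := h.aestronglyMeasurable
  refine ⟨_, stronglyMeasurable_apply_of_forall_measurable e.measurable_functional hφ, ?_⟩
  filter_upwards [hφe] with z hz
  rw [← hz, Function.comp_apply]

variable (p) in
/-- The contraction `ψ ↦ (z ↦ e.functional z (ψ (e.proj z)))` between `Lᵖ` spaces. -/
noncomputable def evalLp [Fact (1 ≤ p)] : Lp E p μ →L[ℂ] Lp ℂ p ν :=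
  LinearMap.mkContinuous
    { toFun := fun ψ => (e.memLp (Lp.memLp ψ)).toLp
      map_add' := fun ψ φ => by
        rw [← MemLp.toLp_add]
        refine MemLp.toLp_congr _ _ ?_
        filter_upwards [e.measurePreserving_proj.quasiMeasurePreserving.ae_eq
          (Lp.coeFn_add ψ φ)] with z hz
        exact (congrArg (e.functional z) hz).trans (map_add (e.functional z) _ _)
      map_smul' := fun c ψ => by
        rw [RingHom.id_apply, ← MemLp.toLp_const_smul]
        refine MemLp.toLp_congr _ _ ?_
        filter_upwards [e.measurePreserving_proj.quasiMeasurePreserving.ae_eq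
          (Lp.coeFn_smul c ψ)] with z hz
        exact (congrArg (e.functional z) hz).trans (map_smul (e.functional z) c _) }
    1 (fun ψ => by
      rw [one_mul, ← Lp.norm_compMeasurePreserving ψ e.measurePreserving_proj]
      refine Lp.norm_le_norm_of_ae_le ?_
      filter_upwards [(e.memLp (Lp.memLp ψ)).coeFn_toLp,
        Lp.coeFn_compMeasurePreserving ψ e.measurePreserving_proj] with z h1 h2
      rw [h2]
      exact (congrArg norm h1).trans_le (e.norm_functional_apply_le z _))

theorem norm_evalLp_le [Fact (1 ≤ p)] : ‖e.evalLp p‖ ≤ 1 :=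
  LinearMap.mkContinuous_norm_le _ zero_le_one _

theorem evalLp_toLp [Fact (1 ≤ p)] {ψ : P → E} (hψ : MemLp ψ p μ) :
    e.evalLp p hψ.toLp = (e.memLp hψ).toLp := by
  refine MemLp.toLp_congr (e.memLp (Lp.memLp _)) _ ?_
  filter_upwards [e.measurePreserving_proj.quasiMeasurePreserving.ae_eq hψ.coeFn_toLp] with z hz
  exact congrArg (e.functional z) hz

theorem coeFn_evalLp_toLp [Fact (1 ≤ p)] {ψ : P → E} (hψ : MemLp ψ p μ) :
    e.evalLp p hψ.toLp =ᵐ[ν] fun z => e.functional z (ψ (e.proj z)) := by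
  rw [evalLp_toLp]
  exact MemLp.coeFn_toLp _

/-- The functional `w ↦ ∫ z, e.functional z (w (e.proj z)) ∂ν` on `L¹`. -/
noncomputable def integralL1 : Lp E 1 μ →L[ℂ] ℂ :=
  (L1.integralCLM' ℂ).comp (e.evalLp 1)

theorem norm_integralL1_le : ‖e.integralL1‖ ≤ 1 := by
  refine ContinuousLinearMap.opNorm_le_bound _ zero_le_one fun w => ?_
  rw [integralL1, ContinuousLinearMap.comp_apply, ← L1.integral_eq']
  exact (L1.norm_integral_le _).trans ((e.evalLp 1).le_of_opNorm_le e.norm_evalLp_le w)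

theorem integralL1_toLp {ψ : P → E} (hψ : MemLp ψ 1 μ) :
    e.integralL1 hψ.toLp = ∫ z, e.functional z (ψ (e.proj z)) ∂ν := by
  rw [integralL1, ContinuousLinearMap.comp_apply, ← L1.integral_eq', L1.integral_eq_integral]
  exact integral_congr_ae (e.coeFn_evalLp_toLp hψ)

theorem integralL1_smulLp (c : E) (g : Lp ℂ 1 μ) :
    e.integralL1 (smulLp ℂ E μ 1 c g) = ∫ z, g (e.proj z) * e.functional z c ∂ν := by
  rw [← Lp.toLp_coeFn (smulLp ℂ E μ 1 c g) (Lp.memLp _), integralL1_toLp]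
  refine integral_congr_ae ?_
  filter_upwards [e.measurePreserving_proj.quasiMeasurePreserving.ae_eq (coeFn_smulLp c g)]
    with z hz
  rw [Function.comp_apply] at hz
  rw [hz, Function.comp_apply, map_smul, smul_eq_mul]

theorem integralL1_toLp_of_eq_norm_sq {σ : E → E}
    (hσ : ∀ z F, e.functional z (σ F) = (‖e.functional z F‖ : ℂ) ^ 2) {ψ : P → E}
    (hψ : MemLp ψ 2 μ) (hσψ : MemLp (fun x => σ (ψ x)) 1 μ) :
    e.integralL1 hσψ.toLp = (‖e.evalLp 2 hψ.toLp‖ : ℂ) ^ 2 := by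
  rw [integralL1_toLp, ← Complex.coe_algebraMap, ← inner_self_eq_norm_sq_to_K (𝕜 := ℂ),
    L2.inner_def]
  refine integral_congr_ae ?_
  filter_upwards [e.coeFn_evalLp_toLp hψ] with z hz
  rw [hσ, hz, inner_self_eq_norm_sq_to_K]
  rfl

end EvaluationFamily

end EvaluationOperator

section ConvergenceOfFunctionals

variable {ι 𝕜 X Y : Type*} [RCLike 𝕜] [NormedAddCommGroup X] [NormedSpace 𝕜 X]
  [NormedAddCommGroup Y] [NormedSpace 𝕜 Y]

/-- The subspace of the vectors at which the operators `l i` converge to `l₀`. -/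
def convergenceSubmodule (F : Filter ι) (l : ι → X →L[𝕜] Y) (l₀ : X →L[𝕜] Y) : Submodule 𝕜 X where
  carrier := {x | Tendsto (fun i => l i x) F (𝓝 (l₀ x))}
  add_mem' hx hy := by simpa only [mem_ofPred_eq, map_add] using Tendsto.add hx hy
  zero_mem' := by simpa only [mem_ofPred_eq, map_zero] using tendsto_const_nhds
  smul_mem' c x hx := by simpa only [mem_ofPred_eq, map_smul] using Tendsto.const_smul hx c

theorem isClosed_convergenceSubmodule (F : Filter ι) {l : ι → X →L[𝕜] Y} (l₀ : X →L[𝕜] Y) {C : ℝ}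
    (hl : ∀ i, ‖l i‖ ≤ C) : IsClosed (convergenceSubmodule F l l₀ : Set X) := by
  have hequi : Equicontinuous (fun i => ⇑(l i)) ↔ ∃ C, ∀ i, ‖l i‖ ≤ C :=
    (NormedSpace.equicontinuous_TFAE l).out 1 5
  exact (hequi.2 ⟨C, hl⟩).isClosed_setOfPred_tendsto l₀.continuous

end ConvergenceOfFunctionals

section FlowMaps

theorem eq_id_of_idempotent_of_isLocallyInjective {X : Type*} [TopologicalSpace X] [T2Space X]
    [PreconnectedSpace X] {f : X → X} (hf : Continuous f) (hinj : IsLocallyInjective f)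
    (hidem : ∀ x, f (f x) = f x) : f = id := by
  have hopen : IsOpen {x | f x = x} := by
    refine isOpen_iff_mem_nhds.2 fun x (hx : f x = x) => ?_
    obtain ⟨U, hU, hxU, hfU⟩ := hinj x
    have hfx : ∀ᶠ y in 𝓝 x, f y ∈ U :=
      hf.continuousAt.eventually_mem (hx.symm ▸ hU.mem_nhds hxU)
    filter_upwards [hU.mem_nhds hxU, hfx] with y hy hfy using hfU hfy hy (hidem y)
  have hclosed : IsClosed {x | f x = x} := isClosed_eq hf continuous_id
  funext x
  exact (IsClopen.eq_univ ⟨hclosed, hopen⟩ ⟨f x, hidem x⟩ ▸ mem_univ x : x ∈ {x | f x = x})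

theorem isLocallyInjective_of_contDiff_of_det_ne_zero {E : Type*} [NormedAddCommGroup E]
    [NormedSpace ℝ E] [FiniteDimensional ℝ E] {f : E → E} (hf : ContDiff ℝ 1 f)
    (hdet : ∀ x, (fderiv ℝ f x).det ≠ 0) : IsLocallyInjective f := by
  have : CompleteSpace E := FiniteDimensional.complete ℝ E
  intro x
  let e : E ≃L[ℝ] E := (fderiv ℝ f x).toContinuousLinearEquivOfDetNeZero (hdet x)
  have hstrict : HasStrictFDerivAt f (e : E →L[ℝ] E) x := by
    rw [ContinuousLinearMap.coe_toContinuousLinearEquivOfDetNeZero]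
    exact hf.contDiffAt.hasStrictFDerivAt one_ne_zero
  let φ := hstrict.toOpenPartialHomeomorph f
  exact ⟨φ.source, φ.open_source, hstrict.mem_toOpenPartialHomeomorph_source, φ.injOn⟩

theorem measurePreserving_of_abs_det_fderiv_eq_one {E : Type*} [NormedAddCommGroup E]
    [NormedSpace ℝ E] [FiniteDimensional ℝ E] [MeasurableSpace E] [BorelSpace E] (μ : Measure E)
    [μ.IsAddHaarMeasure] {f : E → E} (hf : Differentiable ℝ f) (hbij : Function.Bijective f)
    (hdet : ∀ x, |(fderiv ℝ f x).det| = 1) : MeasurePreserving f μ μ := by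
  have hfm : Measurable f := hf.continuous.measurable
  refine ⟨hfm, Measure.ext fun s hs => ?_⟩
  rw [Measure.map_apply hfm hs]
  conv_rhs => rw [← image_preimage_eq s hbij.surjective]
  rw [← lintegral_abs_det_fderiv_eq_addHaar_image μ (hfm hs)
    (fun x _ => (hf x).hasFDerivAt.hasFDerivWithinAt) hbij.injective.injOn]
  simp only [hdet, ENNReal.ofReal_one, lintegral_const, one_mul, Measure.restrict_apply_univ]

theorem exists_norm_le_of_comp_eq_id_of_le_abs_det {E : Type*} [NormedAddCommGroup E]
    [NormedSpace ℝ E] [FiniteDimensional ℝ E] (C : ℝ) {δ : ℝ} (hδ : 0 < δ) :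
    ∃ C', ∀ A B : E →L[ℝ] E, ‖A‖ ≤ C → δ ≤ |A.det| → A.comp B = ContinuousLinearMap.id ℝ E →
      ‖B‖ ≤ C' := by
  have : CompleteSpace E := FiniteDimensional.complete ℝ E
  have : ProperSpace (E →L[ℝ] E) := FiniteDimensional.proper_real _
  let S : Set (E →L[ℝ] E) := {A | ‖A‖ ≤ C ∧ δ ≤ |A.det|}
  have hunit : ∀ A ∈ S, IsUnit A := fun A hA =>
    ContinuousLinearMap.isUnit_iff_isUnit_toLinearMap.2 <|
      (LinearMap.isUnit_iff_isUnit_det _).2 (abs_pos.1 (hδ.trans_le hA.2)).isUnit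
  have hS : IsCompact S :=
    (isCompact_closedBall (0 : E →L[ℝ] E) C).of_isClosed_subset
      ((isClosed_le continuous_norm continuous_const).inter
        (isClosed_le continuous_const ContinuousLinearMap.continuous_det.abs))
      fun A hA => mem_closedBall_zero_iff.2 hA.1
  have hinverse : ContinuousOn (Ring.inverse : (E →L[ℝ] E) → (E →L[ℝ] E)) S := by
    intro A hA
    obtain ⟨u, rfl⟩ := hunit A hA
    exact (NormedRing.inverse_continuousAt u).continuousWithinAt
  obtain ⟨C', hC'⟩ := hS.exists_bound_of_continuousOn hinverse
  refine ⟨C', fun A B hA hdet hAB => ?_⟩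
  have hB : B = Ring.inverse A := by
    obtain ⟨u, rfl⟩ := hunit A ⟨hA, hdet⟩
    rw [Ring.inverse_unit]
    exact (Units.inv_eq_of_mul_eq_one_right hAB).symm
  exact hB ▸ hC' A ⟨hA, hdet⟩

end FlowMaps

namespace IsAdmissibleFlow

variable {d : ℕ} {Φ : ℝ → Space d → Space d}

theorem contDiff_apply (hΦ : IsAdmissibleFlow Φ) (τ : ℝ) : ContDiff ℝ 1 (Φ τ) :=
  hΦ.contDiff.comp (contDiff_const.prodMk contDiff_id)

theorem differentiable (hΦ : IsAdmissibleFlow Φ) (τ : ℝ) : Differentiable ℝ (Φ τ) :=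
  (hΦ.contDiff_apply τ).differentiable one_ne_zero

theorem det_fderiv (hΦ : IsAdmissibleFlow Φ) (τ : ℝ) (x : Space d) :
    (fderiv ℝ (Φ τ) x).det = 1 := by
  simpa only [flowJacobian, neg_neg] using hΦ.volume_preserving (-τ) x

theorem zero_eq_id (hΦ : IsAdmissibleFlow Φ) : Φ 0 = id :=
  eq_id_of_idempotent_of_isLocallyInjective (hΦ.contDiff_apply 0).continuous
    (isLocallyInjective_of_contDiff_of_det_ne_zero (hΦ.contDiff_apply 0) fun x =>
      (hΦ.det_fderiv 0 x).trans_ne one_ne_zero)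
    fun x => by rw [hΦ.group, add_zero]

theorem leftInverse_neg (hΦ : IsAdmissibleFlow Φ) (τ : ℝ) :
    Function.LeftInverse (Φ (-τ)) (Φ τ) := fun x => by
  rw [hΦ.group, neg_add_cancel, hΦ.zero_eq_id, id]

theorem rightInverse_neg (hΦ : IsAdmissibleFlow Φ) (τ : ℝ) :
    Function.RightInverse (Φ (-τ)) (Φ τ) := fun x => by
  rw [hΦ.group, add_neg_cancel, hΦ.zero_eq_id, id]

theorem measurePreserving (hΦ : IsAdmissibleFlow Φ) (τ : ℝ) :
    MeasurePreserving (Φ τ) volume volume :=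
  measurePreserving_of_abs_det_fderiv_eq_one volume (hΦ.differentiable τ)
    ⟨(hΦ.leftInverse_neg τ).injective, (hΦ.rightInverse_neg τ).surjective⟩
    fun x => by rw [hΦ.det_fderiv, abs_one]

theorem exists_norm_fderiv_le (hΦ : IsAdmissibleFlow Φ) {K : Set (Space d)} (hK : IsCompact K) :
    ∃ C, ∀ (τ : ℝ) (x : Space d), Φ τ x ∈ K → ‖fderiv ℝ (Φ τ) x‖ ≤ C := by
  obtain ⟨C, hC⟩ := hΦ.jacobian_bounded K hK
  obtain ⟨C', hC'⟩ := exists_norm_le_of_comp_eq_id_of_le_abs_det (E := Space d) C one_pos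
  refine ⟨C', fun τ x hx => hC' (flowJacobian Φ τ (Φ τ x)) _ (hC _ hx τ) ?_ ?_⟩
  · rw [hΦ.volume_preserving, abs_one]
  · rw [flowJacobian, ← fderiv_comp x (hΦ.differentiable _ _) (hΦ.differentiable _ _),
      (hΦ.leftInverse_neg τ).id, fderiv_id]

end IsAdmissibleFlow

section SpaceTime

variable {d : ℕ} {T : ℝ}

theorem spaceTimeMeasure_eq_prod (d : ℕ) (T : ℝ) :
    spaceTimeMeasure d T = (volume.restrict (Ioo 0 T)).prod (volume : Measure (Space d)) := by
  rw [spaceTimeMeasure, Measure.volume_eq_prod, ← Measure.prod_restrict, Measure.restrict_univ]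

instance : IsFiniteMeasureOnCompacts (spaceTimeMeasure d T) := by
  unfold spaceTimeMeasure; infer_instance

instance : SFinite (spaceTimeMeasure d T) := by
  unfold spaceTimeMeasure; infer_instance

/-- The map `(t, x) ↦ (t, Φ_{-t/ε}(x))` that straightens the flow. -/
noncomputable def flowPullback (Φ : ℝ → Space d → Space d) (ε : ℝ) (p : ℝ × Space d) :
    ℝ × Space d :=
  (p.1, Φ (-p.1 / ε) p.2)

variable {Φ : ℝ → Space d → Space d}

theorem IsAdmissibleFlow.measurePreserving_flowPullback (hΦ : IsAdmissibleFlow Φ) (ε : ℝ) :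
    MeasurePreserving (flowPullback Φ ε) (spaceTimeMeasure d T) (spaceTimeMeasure d T) := by
  have hcont : Continuous fun p : ℝ × Space d => Φ (-p.1 / ε) p.2 :=
    hΦ.contDiff.continuous.comp (f := fun p : ℝ × Space d => (-p.1 / ε, p.2)) (by fun_prop)
  rw [spaceTimeMeasure_eq_prod]
  exact (MeasurePreserving.id _).skew_product (g := fun t => Φ (-t / ε)) hcont.measurable
    (Eventually.of_forall fun t => (hΦ.measurePreserving _).map_eq)

end SpaceTime

section Oscillation

section Antiperiodic

variable {G E : Type*} [AddGroup G] [MeasurableSpace G] [MeasurableAdd G] {μ : Measure G}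
  [μ.IsAddRightInvariant]

theorem norm_integral_mul_le_of_antiperiodic {g e : G → ℂ} {h : G} (hg : Integrable g μ)
    (he : AEStronglyMeasurable e μ) (hbound : ∀ x, ‖e x‖ ≤ 1) (hper : Function.Antiperiodic e h) :
    ‖∫ x, g x * e x ∂μ‖ ≤ (∫ x, ‖g x - g (x + h)‖ ∂μ) / 2 := by
  have hgh : Integrable (fun x => g (x + h)) μ := hg.comp_add_right h
  have hint : Integrable (fun x => g x * e x) μ := hg.mul_bdd he (Eventually.of_forall hbound)
  have hint' : Integrable (fun x => g (x + h) * e x) μ :=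
    hgh.mul_bdd he (Eventually.of_forall hbound)
  have hshift : ∫ x, g x * e x ∂μ = -∫ x, g (x + h) * e x ∂μ := by
    rw [← integral_add_right_eq_self (fun x => g x * e x) h, ← integral_neg]
    simp only [hper _, mul_neg]
  have htwice : 2 * ∫ x, g x * e x ∂μ = ∫ x, (g x - g (x + h)) * e x ∂μ := by
    simp only [sub_mul]
    rw [integral_sub hint hint', two_mul]
    nth_rewrite 2 [hshift]
    rw [sub_eq_add_neg]
  have hle : ‖2 * ∫ x, g x * e x ∂μ‖ ≤ ∫ x, ‖g x - g (x + h)‖ ∂μ := by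
    rw [htwice]
    refine norm_integral_le_of_norm_le (hg.sub hgh).norm (Eventually.of_forall fun x => ?_)
    rw [norm_mul]
    exact mul_le_of_le_one_right (norm_nonneg _) (hbound x)
  rw [norm_mul, Complex.norm_ofNat] at hle
  linarith

theorem integral_norm_sub_add_right_le [NormedAddCommGroup E] {g : G → E} {h : G} {D : ℝ}
    (hD : ∀ x, ‖g x - g (x + h)‖ ≤ D) {S : Set G} (hS : μ S ≠ ⊤) (hgS : Function.support g ⊆ S) :
    ∫ x, ‖g x - g (x + h)‖ ∂μ ≤ 2 * D * μ.real S := by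
  let U := S ∪ (fun x => x + h) ⁻¹' S
  have hpre : μ ((fun x => x + h) ⁻¹' S) = μ S := measure_preimage_add_right μ h S
  have hU : μ U < ⊤ := measure_union_lt_top hS.lt_top (hpre ▸ hS.lt_top)
  have hUS : μ.real U ≤ 2 * μ.real S := by
    refine (measureReal_union_le _ _).trans_eq ?_
    rw [measureReal_def, measureReal_def, hpre, two_mul]
  have hzero : ∀ x ∉ U, ‖g x - g (x + h)‖ = 0 := fun x hx => by
    rw [Function.notMem_support.1 fun hxg => hx (Or.inl (hgS hxg)),
      Function.notMem_support.1 fun hxg => hx (Or.inr (hgS hxg)), sub_zero, norm_zero]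
  calc ∫ x, ‖g x - g (x + h)‖ ∂μ = ∫ x in U, ‖g x - g (x + h)‖ ∂μ :=
        (setIntegral_eq_integral_of_forall_compl_eq_zero hzero).symm
    _ ≤ ‖∫ x in U, ‖g x - g (x + h)‖ ∂μ‖ := Real.le_norm_self _
    _ ≤ D * μ.real U := norm_setIntegral_le_of_norm_le_const hU fun x _ => by
        rw [norm_norm]; exact hD x
    _ ≤ D * (2 * μ.real S) := by
        have hD0 : 0 ≤ D := (norm_nonneg _).trans (hD 0)
        gcongr
    _ = 2 * D * μ.real S := by ring

end Antiperiodic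

variable {d : ℕ} {Φ : ℝ → Space d → Space d}

theorem continuous_toTorus : Continuous (toTorus : Space d → UnitAddTorus (Fin d)) :=
  continuous_pi fun i => (AddCircle.continuous_mk' 1).comp (by fun_prop)

theorem exists_antiperiodic_mFourier {k : Fin d → ℤ} (hk : k ≠ 0) :
    ∃ h : Space d, ‖h‖ ≤ 1 ∧
      Function.Antiperiodic (fun x => UnitAddTorus.mFourier k (toTorus x)) h := by
  obtain ⟨i, hi⟩ := Function.ne_iff.1 hk
  refine ⟨EuclideanSpace.single i (1 / 2 / (k i : ℝ)), ?_, fun x => ?_⟩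
  · have hki : (1 : ℝ) ≤ ‖(k i : ℝ)‖ := by
      rw [Real.norm_eq_abs, ← Int.cast_abs]
      exact_mod_cast Int.one_le_abs hi
    rw [PiLp.norm_single, norm_div, div_le_one (by positivity)]
    exact le_trans (by norm_num) hki
  · have hsplit : ∀ y : UnitAddTorus (Fin d), UnitAddTorus.mFourier k y
        = fourier (k i) (y i) * ∏ j ∈ Finset.univ.erase i, fourier (k j) (y j) := fun y =>
      (Finset.mul_prod_erase Finset.univ (fun j => fourier (k j) (y j)) (Finset.mem_univ i)).symm
    simp only [hsplit, ← neg_mul]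
    congr 1
    · rw [← fourier_add_half_inv_index (T := 1) hi one_pos]
      simp [toTorus]
    · refine Finset.prod_congr rfl fun j hj => ?_
      simp [toTorus, Finset.ne_of_mem_erase hj]

theorem norm_integral_mul_mFourier_le {k : Fin d → ℤ} (hk : k ≠ 0) {g : Space d → ℂ}
    (hg : Integrable g) {L : NNReal} (hL : LipschitzWith L g) {S : Set (Space d)}
    (hS : volume S ≠ ⊤) (hgS : Function.support g ⊆ S) {ε : ℝ} (hε : 0 < ε) :
    ‖∫ x, g x * UnitAddTorus.mFourier k (toTorus (ε⁻¹ • x))‖ ≤ L * ε * volume.real S := by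
  obtain ⟨h, hh, hper⟩ := exists_antiperiodic_mFourier hk
  let e : Space d → ℂ := fun x => UnitAddTorus.mFourier k (toTorus (ε⁻¹ • x))
  have he : Continuous e :=
    (UnitAddTorus.mFourier k).continuous.comp (continuous_toTorus.comp (by fun_prop))
  have hbound : ∀ x, ‖e x‖ ≤ 1 := fun x =>
    ((UnitAddTorus.mFourier k).norm_coe_le_norm _).trans_eq UnitAddTorus.mFourier_norm
  have heper : Function.Antiperiodic e (ε • h) := fun x => by
    simp only [e, smul_add, inv_smul_smul₀ hε.ne']
    exact hper _
  have hgshift : ∀ x, ‖g x - g (x + ε • h)‖ ≤ L * ε := fun x => by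
    refine (hL.norm_sub_le _ _).trans ?_
    rw [sub_add_cancel_left, norm_neg, norm_smul, Real.norm_of_nonneg hε.le]
    exact mul_le_mul_of_nonneg_left (mul_le_of_le_one_right hε.le hh) L.coe_nonneg
  have hosc := norm_integral_mul_le_of_antiperiodic hg he.aestronglyMeasurable hbound heper
  have hsub := integral_norm_sub_add_right_le hgshift hS hgS
  linarith

theorem IsAdmissibleFlow.exists_lipschitzWith_comp (hΦ : IsAdmissibleFlow Φ)
    {w : ℝ × Space d → ℂ} (hw : ContDiff ℝ 1 w) (hwc : HasCompactSupport w) :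
    ∃ L, ∀ t τ : ℝ, LipschitzWith L fun x => w (t, Φ τ x) := by
  obtain ⟨M, hM⟩ := (hw.continuous_fderiv one_ne_zero).bounded_above_of_compact_support
    (hwc.fderiv (𝕜 := ℝ))
  obtain ⟨C, hC⟩ := hΦ.exists_norm_fderiv_le (hwc.isCompact.image continuous_snd)
  refine ⟨(M * C).toNNReal, fun t τ => ?_⟩
  have hderiv : ∀ x, HasFDerivAt (fun x => w (t, Φ τ x))
      ((fderiv ℝ w (t, Φ τ x)).comp ((ContinuousLinearMap.inr ℝ ℝ (Space d)).comp
        (fderiv ℝ (Φ τ) x))) x := fun x =>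
    (hw.differentiable one_ne_zero _).hasFDerivAt.comp x
      ((hasFDerivAt_prodMk_right t _).comp x (hΦ.differentiable τ x).hasFDerivAt)
  refine lipschitzWith_of_nnnorm_fderiv_le (𝕜 := ℝ) (fun x => (hderiv x).differentiableAt)
    fun x => ?_
  rw [(hderiv x).fderiv, ← NNReal.coe_le_coe, coe_nnnorm]
  by_cases hx : (t, Φ τ x) ∈ tsupport w
  · refine le_trans ?_ (Real.le_coe_toNNReal _)
    refine (ContinuousLinearMap.opNorm_comp_le _ _).trans
      (mul_le_mul (hM _) ?_ (norm_nonneg _) ((norm_nonneg _).trans (hM 0)))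
    refine (ContinuousLinearMap.opNorm_comp_le _ _).trans ?_
    exact (mul_le_of_le_one_left (norm_nonneg _) (ContinuousLinearMap.norm_inr_le_one _ _ _)).trans
      (hC τ x ⟨_, hx, rfl⟩)
  · rw [fderiv_of_notMem_tsupport ℝ hx, ContinuousLinearMap.zero_comp, norm_zero]
    exact NNReal.coe_nonneg _

theorem IsAdmissibleFlow.exists_norm_integral_comp_mul_mFourier_le (hΦ : IsAdmissibleFlow Φ)
    {k : Fin d → ℤ} (hk : k ≠ 0) {w : ℝ × Space d → ℂ} (hw : ContDiff ℝ 1 w)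
    (hwc : HasCompactSupport w) :
    ∃ C, ∀ t τ ε : ℝ, 0 < ε →
      ‖∫ x, w (t, Φ τ x) * UnitAddTorus.mFourier k (toTorus (ε⁻¹ • x))‖ ≤ C * ε := by
  obtain ⟨L, hL⟩ := hΦ.exists_lipschitzWith_comp hw hwc
  let K : Set (Space d) := Prod.snd '' tsupport w
  have hK : IsCompact K := hwc.isCompact.image continuous_snd
  refine ⟨L * volume.real K, fun t τ ε hε => ?_⟩
  have hvol : volume (Φ τ ⁻¹' K) = volume K :=
    (hΦ.measurePreserving τ).measure_preimage hK.measurableSet.nullMeasurableSet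
  have hsupp : Function.support (fun x => w (t, x)) ⊆ K :=
    fun x hx => ⟨(t, x), subset_tsupport w hx, rfl⟩
  have hint : Integrable fun x => w (t, Φ τ x) :=
    (hΦ.measurePreserving τ).integrable_comp_of_integrable
      ((hw.continuous.comp (.prodMk_right t)).integrable_of_hasCompactSupport
        (.intro hK fun x hx => Function.notMem_support.1 fun h => hx (hsupp h)))
  refine (norm_integral_mul_mFourier_le hk hint (hL t τ) (S := Φ τ ⁻¹' K)
    (hvol ▸ hK.measure_lt_top.ne) (preimage_mono hsupp) hε).trans_eq ?_
  rw [measureReal_def, hvol, ← measureReal_def]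
  ring

end Oscillation

section ProductAlgebra

instance : IsProbabilityMeasure (volume : Measure UnitAddCircle) :=
  ⟨UnitAddCircle.measure_univ⟩

theorem integral_fourier (n : ℤ) :
    ∫ y : UnitAddCircle, fourier n y = if n = 0 then (1 : ℂ) else 0 := by
  have h := orthonormal_iff_ite.1 (orthonormal_fourier (T := 1)) 0 n
  rw [fourierLp, fourierLp, ContinuousMap.inner_toLp] at h
  rw [AddCircle.volume_eq_smul_haarAddCircle, ENNReal.ofReal_one, one_smul]
  simpa [eq_comm] using h

theorem integral_mFourier {ι : Type*} [Fintype ι] (k : ι → ℤ) :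
    ∫ y : UnitAddTorus ι, UnitAddTorus.mFourier k y = if k = 0 then (1 : ℂ) else 0 := by
  have hprod : ∫ y, UnitAddTorus.mFourier k y = ∏ i, ∫ y : UnitAddCircle, fourier (k i) y :=
    integral_fintype_prod_volume_eq_prod fun i (y : UnitAddCircle) => fourier (k i) y
  simp only [hprod, integral_fourier]
  by_cases hk : k = 0
  · simp [hk]
  · obtain ⟨i, hi⟩ := Function.ne_iff.1 hk
    rw [if_neg hk]
    exact Finset.prod_eq_zero (Finset.mem_univ i) (if_neg hi)

namespace AlgebraWithMeanValue

variable (A : AlgebraWithMeanValue) {d : ℕ}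

/-- The product `f(τ) g(y)` as an element of `A ⊙ C(𝕋^d)`, linear in `g`. -/
noncomputable def tensor (f : A.Alg) : C(Torus d, ℂ) →L[ℂ] A.productAlgebra d :=
  LinearMap.mkContinuous
    { toFun := fun g =>
        ⟨f.1.compContinuous ⟨Prod.fst, continuous_fst⟩ *
            (BoundedContinuousFunction.mkOfCompact g).compContinuous ⟨Prod.snd, continuous_snd⟩,
          Submodule.le_topologicalClosure _ (Submodule.subset_span ⟨f, g, fun _ _ => rfl⟩)⟩
      map_add' := fun g h => by
        ext p
        exact mul_add _ _ _
      map_smul' := fun c g => by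
        ext p
        exact mul_left_comm _ _ _ }
    ‖f.1‖ fun g => (BoundedContinuousFunction.norm_le (by positivity)).2 fun p =>
      (norm_mul_le _ _).trans (mul_le_mul (f.1.norm_coe_le_norm _) (g.norm_coe_le_norm _)
        (norm_nonneg _) (norm_nonneg _))

/-- The product `f(τ) e_k(y)` with the character `e_k` of the torus. -/
noncomputable def fourierTensor (f : A.Alg) (k : Fin d → ℤ) : A.productAlgebra d :=
  A.tensor f (UnitAddTorus.mFourier k)

variable (d) in
/-- The set of the products `f(τ) e_k(y)`, which is total in `A ⊙ C(𝕋^d)`. -/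
def fourierTensors : Set (A.productAlgebra d) := {F | ∃ f k, F = A.fourierTensor f k}

theorem tensor_mem_topologicalClosure_span_fourierTensors (f : A.Alg) (g : C(Torus d, ℂ)) :
    A.tensor f g ∈ (Submodule.span ℂ (A.fourierTensors d)).topologicalClosure := by
  have hle : (Submodule.span ℂ (range UnitAddTorus.mFourier)).topologicalClosure ≤
      (Submodule.span ℂ (A.fourierTensors d)).topologicalClosure.comap
        (A.tensor f).toLinearMap := by
    refine Submodule.topologicalClosure_minimal _ (Submodule.span_le.2 ?_)
      ((Submodule.isClosed_topologicalClosure _).preimage (A.tensor f).continuous)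
    rintro _ ⟨k, rfl⟩
    exact Submodule.le_topologicalClosure _ (Submodule.subset_span ⟨f, k, rfl⟩)
  rw [UnitAddTorus.span_mFourier_closure_eq_top] at hle
  exact hle (Submodule.mem_top : g ∈ _)

theorem topologicalClosure_span_fourierTensors :
    (Submodule.span ℂ (A.fourierTensors d)).topologicalClosure = ⊤ := by
  let W := (Submodule.span ℂ (A.fourierTensors d)).topologicalClosure
  have hclosed : IsClosed (W.map (A.productAlgebra d).subtype : Set ((ℝ × Torus d) →ᵇ ℂ)) := by
    have hE : IsClosed (A.productAlgebra d : Set ((ℝ × Torus d) →ᵇ ℂ)) :=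
      Submodule.isClosed_topologicalClosure _
    rw [Submodule.map_coe]
    exact hE.isClosedEmbedding_subtypeVal.isClosedMap _ (Submodule.isClosed_topologicalClosure _)
  have hle : A.productAlgebra d ≤ W.map (A.productAlgebra d).subtype := by
    refine Submodule.topologicalClosure_minimal _ (Submodule.span_le.2 ?_) hclosed
    rintro F ⟨f, g, hF⟩
    exact ⟨A.tensor f g, A.tensor_mem_topologicalClosure_span_fourierTensors f g,
      BoundedContinuousFunction.ext fun p => (hF p.1 p.2).symm⟩
  refine Submodule.eq_top_iff'.2 fun F => ?_
  obtain ⟨F', hF', hFF'⟩ := hle F.2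
  exact Subtype.ext hFF' ▸ hF'

theorem star_mul_mem {F G : (ℝ × Torus d) →ᵇ ℂ} (hF : F ∈ A.productAlgebra d)
    (hG : G ∈ A.productAlgebra d) : star F * G ∈ A.productAlgebra d := by
  refine map_mem_closure₂ (f := fun F G : (ℝ × Torus d) →ᵇ ℂ => star F * G) (by fun_prop) hF hG
    fun F hF G hG => ?_
  suffices h : star F * G ∈ Submodule.span ℂ {F : (ℝ × Torus d) →ᵇ ℂ |
      ∃ (f : A.Alg) (g : C(Torus d, ℂ)), ∀ τ y, F (τ, y) = f.1 τ * g y} from h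
  induction hF, hG using Submodule.span_induction₂ with
  | mem_mem F G hF hG =>
    obtain ⟨f, a, hF⟩ := hF
    obtain ⟨g, b, hG⟩ := hG
    refine Submodule.subset_span ⟨star f * g, star a * b, fun τ y => ?_⟩
    change star (F (τ, y)) * G (τ, y) = star (f.1 τ) * g.1 τ * (star (a y) * b y)
    rw [hF, hG, star_mul']
    ring
  | zero_left => simp only [star_zero, zero_mul, Submodule.zero_mem]
  | zero_right => simp only [mul_zero, Submodule.zero_mem]
  | add_left F F' G _ _ _ h h' => simpa only [star_add, add_mul] using Submodule.add_mem _ h h'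
  | add_right F G G' _ _ _ h h' => simpa only [mul_add] using Submodule.add_mem _ h h'
  | smul_left c F G _ _ h =>
    simpa only [star_smul, smul_mul_assoc] using Submodule.smul_mem _ (star c) h
  | smul_right c F G _ _ h => simpa only [mul_smul_comm] using Submodule.smul_mem _ c h

/-- The element `|F|²` of `A ⊙ C(𝕋^d)`. -/
noncomputable def absSq (F : A.productAlgebra d) : A.productAlgebra d :=
  ⟨star F.1 * F.1, A.star_mul_mem F.2 F.2⟩

theorem absSq_apply (F : A.productAlgebra d) (p : ℝ × Torus d) :
    (A.absSq F).1 p = (‖F.1 p‖ : ℂ) ^ 2 :=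
  Complex.conj_mul' (F.1 p)

theorem norm_absSq (F : A.productAlgebra d) : ‖A.absSq F‖ = ‖F‖ ^ 2 :=
  (CStarRing.norm_star_mul_self (x := F.1)).trans (sq _).symm

theorem continuous_absSq : Continuous (A.absSq (d := d)) :=
  Continuous.subtype_mk (by fun_prop) _

theorem memLp_absSq {P : Type*} [MeasurableSpace P] {μ : Measure P} {ψ : P → A.productAlgebra d}
    (hψ : MemLp ψ 2 μ) : MemLp (fun x => A.absSq (ψ x)) 1 μ := by
  refine memLp_one_iff_integrable.2 ((hψ.integrable_norm_pow two_ne_zero).mono'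
    (A.continuous_absSq.comp_aestronglyMeasurable hψ.aestronglyMeasurable) ?_)
  exact Eventually.of_forall fun x => (A.norm_absSq _).le

theorem gelfandHat_absSq (F : A.productAlgebra d) (q : A.Spectrum × Torus d) :
    A.gelfandHat (A.absSq F) q = (‖A.gelfandHat F q‖ : ℂ) ^ 2 := by
  let f : A.Alg := ⟨slice F.1 q.2, A.slice_mem F q.2⟩
  change q.1 (star f * f) = (‖q.1 f‖ : ℂ) ^ 2
  rw [map_mul, map_star]
  exact Complex.conj_mul' _

theorem gelfandHat_tensor (f : A.Alg) (g : C(Torus d, ℂ)) (q : A.Spectrum × Torus d) :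
    A.gelfandHat (A.tensor f g) q = q.1 f * g q.2 := by
  have hslice : (⟨slice (A.tensor f g).1 q.2, A.slice_mem (A.tensor f g) q.2⟩ : A.Alg)
      = g q.2 • f := by
    ext τ
    exact mul_comm _ _
  rw [gelfandHat, hslice, map_smul, mul_comm]
  rfl

theorem integral_gelfandHat_fourierTensor (f : A.Alg) (k : Fin d → ℤ) :
    ∫ q, A.gelfandHat (A.fourierTensor f k) q ∂A.meanMeasure.prod volume
      = A.mean f * if k = 0 then 1 else 0 := by
  simp only [fourierTensor, gelfandHat_tensor]
  rw [integral_prod_mul (fun s : A.Spectrum => s f), integral_mFourier, A.mean_eq_integral]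
  rfl

theorem norm_gelfandHat_le (F : A.productAlgebra d) (q : A.Spectrum × Torus d) :
    ‖A.gelfandHat F q‖ ≤ ‖F‖ := by
  refine (spectrum.norm_le_norm_of_mem (AlgHom.apply_mem_spectrum
    (WeakDual.CharacterSpace.toAlgHom q.1)
    (⟨slice F.1 q.2, A.slice_mem F q.2⟩ : A.Alg))).trans ?_
  exact (BoundedContinuousFunction.norm_le (norm_nonneg _)).2 fun τ => F.1.norm_coe_le_norm _

/-- The evaluation `F ↦ F̂(s, y)`. -/
noncomputable def gelfandEval (q : A.Spectrum × Torus d) : A.productAlgebra d →L[ℂ] ℂ :=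
  LinearMap.mkContinuous
    { toFun := fun F => A.gelfandHat F q
      map_add' := fun F G => map_add q.1 (⟨slice F.1 q.2, A.slice_mem F q.2⟩ : A.Alg)
        ⟨slice G.1 q.2, A.slice_mem G q.2⟩
      map_smul' := fun c F => map_smul q.1 c (⟨slice F.1 q.2, A.slice_mem F q.2⟩ : A.Alg) }
    1 fun F => (A.norm_gelfandHat_le F q).trans_eq (one_mul _).symm

-- The spectrum need not be second countable, so continuity of `A.gelfandHat F` does not give
-- measurability for the product `σ`-algebra.
theorem measurable_gelfandHat (F : A.productAlgebra d) : Measurable (A.gelfandHat F) := by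
  have hspan : ∀ G ∈ Submodule.span ℂ (A.fourierTensors d),
      Measurable fun q => A.gelfandEval q G := by
    intro G hG
    induction hG using Submodule.span_induction with
    | mem G hG =>
      obtain ⟨f, k, rfl⟩ := hG
      have hf : Measurable fun s : A.Spectrum => s f :=
        (WeakDual.gelfandTransform ℂ A.Alg f).continuous.measurable
      change Measurable (A.gelfandHat _)
      rw [fourierTensor, funext (A.gelfandHat_tensor f _)]
      exact (hf.comp measurable_fst).mul
        ((UnitAddTorus.mFourier k).continuous.measurable.comp measurable_snd)
    | zero => simp only [map_zero, measurable_const]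
    | add F G _ _ hF hG => simpa only [map_add] using hF.fun_add hG
    | smul c F _ hF => simpa only [map_smul] using hF.fun_const_smul c
  have hF : F ∈ closure (Submodule.span ℂ (A.fourierTensors d) : Set (A.productAlgebra d)) := by
    rw [← Submodule.topologicalClosure_coe, topologicalClosure_span_fourierTensors]
    trivial
  obtain ⟨G, hG, hGF⟩ := mem_closure_iff_seq_limit.1 hF
  exact measurable_of_tendsto_metrizable (fun n => hspan (G n) (hG n))
    (tendsto_pi_nhds.2 fun q => ((A.gelfandEval q).continuous.tendsto F).comp hGF)

end AlgebraWithMeanValue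

end ProductAlgebra

section MeanValueTheorem

variable {d : ℕ} {T : ℝ} {Φ : ℝ → Space d → Space d}

theorem HasMeanValue.tendsto_integral_mul {P : Type*} [MeasurableSpace P] {μ : Measure P}
    [SFinite μ] {s : Set ℝ} (hs : MeasurableSet s) {f : ℝ →ᵇ ℂ} {m : ℂ} (hf : HasMeanValue f m)
    {g : ℝ × P → ℂ} (hg : Integrable g ((volume.restrict s).prod μ)) :
    Tendsto (fun ε : ℝ => ∫ p, g p * f (p.1 / ε) ∂(volume.restrict s).prod μ) (𝓝[>] 0)
      (𝓝 (m * ∫ p, g p ∂(volume.restrict s).prod μ)) := by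
  have hint : Integrable (s.indicator fun t => ∫ x, g (t, x) ∂μ) :=
    (integrable_indicator_iff hs).2 hg.integral_prod_left
  have h := hf _ hint
  rw [integral_const_mul, integral_indicator hs, ← integral_prod g hg] at h
  refine h.congr fun ε => ?_
  have hcont : Continuous fun t : ℝ => f (t / ε) := f.continuous.comp (by fun_prop)
  have hgf : Integrable (fun p => g p * f (p.1 / ε)) ((volume.restrict s).prod μ) :=
    hg.mul_bdd (hcont.measurable.comp measurable_fst).aestronglyMeasurable
      (Eventually.of_forall fun p => f.norm_coe_le_norm _)
  rw [integral_prod _ hgf, ← integral_indicator hs]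
  congr 1
  ext t
  by_cases ht : t ∈ s
  · simp only [indicator_of_mem ht]
    rw [integral_mul_const, mul_comm]
  · simp only [indicator_of_notMem ht, mul_zero]

theorem HasMeanValue.tendsto_integral_comp_flowPullback_mul {f : ℝ →ᵇ ℂ} {m : ℂ}
    (hf : HasMeanValue f m) (hΦ : IsAdmissibleFlow Φ) {g : ℝ × Space d → ℂ}
    (hg : Integrable g (spaceTimeMeasure d T)) :
    Tendsto (fun ε => ∫ p, g (flowPullback Φ ε p) * f (p.1 / ε) ∂spaceTimeMeasure d T) (𝓝[>] 0)
      (𝓝 (m * ∫ p, g p ∂spaceTimeMeasure d T)) := by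
  have h := hf.tendsto_integral_mul measurableSet_Ioo (spaceTimeMeasure_eq_prod d T ▸ hg)
  rw [← spaceTimeMeasure_eq_prod] at h
  refine h.congr fun ε => ?_
  have hpres := hΦ.measurePreserving_flowPullback (T := T) ε
  have hcont : Continuous fun p : ℝ × Space d => f (p.1 / ε) := f.continuous.comp (by fun_prop)
  have hmap := integral_map hpres.aemeasurable (f := fun p => g p * f (p.1 / ε))
    (hpres.map_eq.symm ▸ hg.aestronglyMeasurable.mul hcont.aestronglyMeasurable)
  rwa [hpres.map_eq] at hmap

namespace AlgebraWithMeanValue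

variable (A : AlgebraWithMeanValue)

variable (d T) in
/-- The family of evaluations `F ↦ F̂(s, y)`, whose associated operator is `ψ ↦ ψ̂`. -/
noncomputable def gelfandFamily :
    EvaluationFamily (A.productAlgebra d) (limitMeasure A d T) (spaceTimeMeasure d T) where
  functional q := A.gelfandEval q.2
  measurable_functional F := (A.measurable_gelfandHat F).comp measurable_snd
  norm_functional_le _ := LinearMap.mkContinuous_norm_le _ zero_le_one _
  proj := Prod.fst
  measurePreserving_proj := measurePreserving_fst

variable (T) in
/-- The family whose associated operator sends `ψ` to the oscillating function
`ψ(t, Φ_{-t/ε}(x), t/ε, x/ε)`. -/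
noncomputable def traceFamily (hΦ : IsAdmissibleFlow Φ) (ε : ℝ) :
    EvaluationFamily (A.productAlgebra d) (spaceTimeMeasure d T) (spaceTimeMeasure d T) where
  functional p := (BoundedContinuousFunction.evalCLM ℂ (p.1 / ε, toTorus (ε⁻¹ • p.2))).comp
    (A.productAlgebra d).subtypeL
  measurable_functional F := by
    have htorus := continuous_toTorus (d := d)
    have hpoint : Continuous fun p : ℝ × Space d => (p.1 / ε, toTorus (ε⁻¹ • p.2)) := by fun_prop
    exact (F.1.continuous.comp hpoint).measurable
  norm_functional_le _ := ContinuousLinearMap.opNorm_le_bound _ zero_le_one fun F =>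
    (F.1.norm_coe_le_norm _).trans_eq (one_mul _).symm
  proj := flowPullback Φ ε
  measurePreserving_proj := hΦ.measurePreserving_flowPullback ε

theorem integralL1_gelfandFamily_smulLp_fourierTensor (f : A.Alg) (k : Fin d → ℤ)
    (g : Lp ℂ 1 (spaceTimeMeasure d T)) :
    (A.gelfandFamily d T).integralL1 (smulLp _ _ _ 1 (A.fourierTensor f k) g)
      = if k = 0 then A.mean f * ∫ p, g p ∂spaceTimeMeasure d T else 0 := by
  rw [EvaluationFamily.integralL1_smulLp]
  change ∫ q, g q.1 * A.gelfandHat _ q.2 ∂(spaceTimeMeasure d T).prod _ = _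
  rw [integral_prod_mul (fun p => g p), integral_gelfandHat_fourierTensor]
  split_ifs <;> ring

theorem integralL1_traceFamily_smulLp_fourierTensor (hΦ : IsAdmissibleFlow Φ) (ε : ℝ) (f : A.Alg)
    (k : Fin d → ℤ) (g : Lp ℂ 1 (spaceTimeMeasure d T)) :
    (A.traceFamily T hΦ ε).integralL1 (smulLp _ _ _ 1 (A.fourierTensor f k) g)
      = ∫ p, g (flowPullback Φ ε p) *
          (f.1 (p.1 / ε) * UnitAddTorus.mFourier k (toTorus (ε⁻¹ • p.2)))
            ∂spaceTimeMeasure d T :=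
  EvaluationFamily.integralL1_smulLp _ _ _

theorem tendsto_integralL1_traceFamily_fourierTensor_zero (hΦ : IsAdmissibleFlow Φ) (f : A.Alg)
    (g : Lp ℂ 1 (spaceTimeMeasure d T)) :
    Tendsto (fun ε => (A.traceFamily T hΦ ε).integralL1
        (smulLp _ _ _ 1 (A.fourierTensor f 0) g)) (𝓝[>] 0)
      (𝓝 (A.mean f * ∫ p, g p ∂spaceTimeMeasure d T)) := by
  refine ((A.hasMeanValue_mean f).tendsto_integral_comp_flowPullback_mul hΦ
    (L1.integrable_coeFn g)).congr fun ε => ?_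
  simp only [integralL1_traceFamily_smulLp_fourierTensor, UnitAddTorus.mFourier_zero,
    ContinuousMap.one_apply, mul_one]

theorem exists_norm_integral_fourierTensor_le (hΦ : IsAdmissibleFlow Φ) (f : A.Alg)
    {k : Fin d → ℤ} (hk : k ≠ 0) {w : ℝ × Space d → ℂ} (hw : ContDiff ℝ 1 w)
    (hwc : HasCompactSupport w) :
    ∃ C, ∀ ε, 0 < ε → ‖∫ p, w (flowPullback Φ ε p) *
      (f.1 (p.1 / ε) * UnitAddTorus.mFourier k (toTorus (ε⁻¹ • p.2))) ∂spaceTimeMeasure d T‖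
        ≤ C * ε := by
  obtain ⟨C, hC⟩ := hΦ.exists_norm_integral_comp_mul_mFourier_le hk hw hwc
  refine ⟨‖f.1‖ * C * volume.real (Ioo 0 T), fun ε hε => ?_⟩
  have hint : Integrable (fun p => w (flowPullback Φ ε p) *
      (f.1 (p.1 / ε) * UnitAddTorus.mFourier k (toTorus (ε⁻¹ • p.2)))) (spaceTimeMeasure d T) := by
    have hm : MemLp (fun p => w p • A.fourierTensor f k) 1 (spaceTimeMeasure d T) :=
      memLp_one_iff_integrable.2 ((hw.continuous.integrable_of_hasCompactSupport hwc).smul_const _)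
    exact memLp_one_iff_integrable.1 ((A.traceFamily T hΦ ε).memLp hm)
  have hslice : ∀ t, ‖∫ x, w (t, Φ (-t / ε) x) *
      (f.1 (t / ε) * UnitAddTorus.mFourier k (toTorus (ε⁻¹ • x)))‖ ≤ ‖f.1‖ * (C * ε) := by
    intro t
    simp only [mul_left_comm _ (f.1 (t / ε))]
    rw [integral_const_mul, norm_mul]
    exact mul_le_mul (f.1.norm_coe_le_norm _) (hC _ _ _ hε) (norm_nonneg _) (norm_nonneg _)
  rw [spaceTimeMeasure_eq_prod] at hint ⊢
  rw [integral_prod _ hint]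
  refine (norm_setIntegral_le_of_norm_le_const (by simp) fun t _ => hslice t).trans_eq ?_
  ring

theorem tendsto_integralL1_traceFamily_fourierTensor (hΦ : IsAdmissibleFlow Φ) (f : A.Alg)
    {k : Fin d → ℤ} (hk : k ≠ 0) {w : ℝ × Space d → ℂ} (hw : ContDiff ℝ 1 w)
    (hwc : HasCompactSupport w) {g : Lp ℂ 1 (spaceTimeMeasure d T)}
    (hgw : g =ᵐ[spaceTimeMeasure d T] w) :
    Tendsto (fun ε => (A.traceFamily T hΦ ε).integralL1
        (smulLp _ _ _ 1 (A.fourierTensor f k) g)) (𝓝[>] 0) (𝓝 0) := by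
  obtain ⟨C, hC⟩ := A.exists_norm_integral_fourierTensor_le (T := T) hΦ f hk hw hwc
  refine squeeze_zero_norm' (a := fun ε => C * ε) ?_ ?_
  · filter_upwards [self_mem_nhdsWithin] with ε hε
    refine le_of_eq_of_le ?_ (hC ε hε)
    rw [integralL1_traceFamily_smulLp_fourierTensor]
    congr 1
    refine integral_congr_ae ?_
    filter_upwards [(hΦ.measurePreserving_flowPullback ε).quasiMeasurePreserving.ae_eq hgw]
      with p hp
    exact congrArg (· * _) hp
  · exact ((continuous_const_mul C).tendsto' 0 0 (mul_zero C)).mono_left nhdsWithin_le_nhds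

theorem tendsto_integralL1_traceFamily (hΦ : IsAdmissibleFlow Φ)
    (w : Lp (A.productAlgebra d) 1 (spaceTimeMeasure d T)) :
    Tendsto (fun ε => (A.traceFamily T hΦ ε).integralL1 w) (𝓝[>] 0)
      (𝓝 ((A.gelfandFamily d T).integralL1 w)) := by
  let V := convergenceSubmodule (𝓝[>] 0) (fun ε => (A.traceFamily T hΦ ε).integralL1)
    (A.gelfandFamily d T).integralL1
  have hV : IsClosed (V : Set (Lp (A.productAlgebra d) 1 (spaceTimeMeasure d T))) :=
    isClosed_convergenceSubmodule _ _ fun ε => EvaluationFamily.norm_integralL1_le _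
  suffices hV_top : V = ⊤ from (hV_top ▸ Submodule.mem_top : w ∈ V)
  refine eq_top_of_smulLp_mem ENNReal.one_ne_top A.topologicalClosure_span_fourierTensors hV ?_
  rintro _ ⟨f, k, rfl⟩ g
  have hlim := A.integralL1_gelfandFamily_smulLp_fourierTensor (d := d) (T := T) f k
  by_cases hk : k = 0
  · subst hk
    exact (A.tendsto_integralL1_traceFamily_fourierTensor_zero hΦ f g).mono_right
      (congrArg 𝓝 ((hlim g).trans (if_pos rfl)).symm).le
  · refine (Lp.dense_hasCompactSupport_contDiff ENNReal.one_ne_top).induction ?_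
      (hV.preimage (smulLp ℂ (A.productAlgebra d) (spaceTimeMeasure d T) 1 _).continuous) g
    rintro g ⟨w, hgw, hwc, hw⟩
    exact (A.tendsto_integralL1_traceFamily_fourierTensor hΦ f hk (hw.of_le (by simp)) hwc
      hgw).mono_right (congrArg 𝓝 ((hlim g).trans (if_neg hk)).symm).le

theorem tendsto_norm_evalLp_traceFamily (hΦ : IsAdmissibleFlow Φ)
    (ψ : Lp (A.productAlgebra d) 2 (spaceTimeMeasure d T)) :
    Tendsto (fun ε => ‖(A.traceFamily T hΦ ε).evalLp 2 ψ‖) (𝓝[>] 0)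
      (𝓝 ‖(A.gelfandFamily d T).evalLp 2 ψ‖) := by
  have hψ := Lp.memLp ψ
  have htrace : ∀ ε, _ := fun ε => (A.traceFamily T hΦ ε).integralL1_toLp_of_eq_norm_sq
    (fun p F => A.absSq_apply F _) hψ (A.memLp_absSq hψ)
  have hgelfand := (A.gelfandFamily d T).integralL1_toLp_of_eq_norm_sq
    (fun q F => A.gelfandHat_absSq F q.2) hψ (A.memLp_absSq hψ)
  have h := A.tendsto_integralL1_traceFamily hΦ (A.memLp_absSq hψ).toLp
  simp only [htrace, hgelfand, Lp.toLp_coeFn] at h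
  simpa only [norm_pow, Complex.norm_real, norm_norm, Real.sqrt_sq (norm_nonneg _)]
    using h.norm.sqrt

end AlgebraWithMeanValue

end MeanValueTheorem

section L2

variable {𝕜 Z : Type*} [RCLike 𝕜] [MeasurableSpace Z] {ν : Measure Z}

theorem norm_Lp_star_le {p : ENNReal} (u : Lp 𝕜 p ν) : ‖star u‖ ≤ ‖u‖ := by
  refine Lp.norm_le_norm_of_ae_le ?_
  filter_upwards [Lp.coeFn_star u] with z hz
  rw [hz, Pi.star_apply, norm_star]

theorem inner_star_eq_integral (u : Lp 𝕜 2 ν) {v : Lp 𝕜 2 ν} {g : Z → 𝕜} (hg : v =ᵐ[ν] g) :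
    inner 𝕜 (star u) v = ∫ z, u z * g z ∂ν := by
  rw [L2.inner_def]
  refine integral_congr_ae ?_
  filter_upwards [hg, Lp.coeFn_star u] with z h1 h2
  rw [h1, h2, Pi.star_apply, RCLike.inner_apply', RCLike.star_def, RCLike.conj_conj]

end L2

theorem mainTheorem2_general (A : AlgebraWithMeanValue) {d : ℕ} {T : ℝ}
    {Φ : ℝ → Space d → Space d} (hΦ : IsAdmissibleFlow Φ) {ε : ℕ → ℝ}
    (hε : Tendsto ε atTop (𝓝[>] 0)) {u : ℕ → Lp ℂ 2 (spaceTimeMeasure d T)} {C : ℝ}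
    (hu : ∀ n, ‖u n‖ ≤ C) :
    ∃ k : ℕ → ℕ, StrictMono k ∧ ∃ u₀ : Lp ℂ 2 (limitMeasure A d T),
      ∀ ψ : ℝ × Space d → A.productAlgebra d, MemLp ψ 2 (spaceTimeMeasure d T) →
        Tendsto
          (fun n => ∫ p, u (k n) p * (ψ (p.1, Φ (-p.1 / ε (k n)) p.2)).1
            (p.1 / ε (k n), toTorus ((ε (k n))⁻¹ • p.2)) ∂spaceTimeMeasure d T)
          atTop
          (𝓝 (∫ q, u₀ q * A.gelfandHat (ψ q.1) q.2 ∂limitMeasure A d T)) := by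
  let trace n := (A.traceFamily T hΦ (ε n)).evalLp 2
  let gelfand := (A.gelfandFamily d T).evalLp 2
  let l n := ((innerSL ℂ (star (u n))).comp (trace n)).toLinearMap
  have hdom : IsAsymptoticallyDominated atTop l gelfand.toLinearMap C := by
    intro ψ c hc
    have htrace : Tendsto (fun n => C * ‖trace n ψ‖) atTop (𝓝 (C * ‖gelfand ψ‖)) :=
      ((A.tendsto_norm_evalLp_traceFamily hΦ ψ).comp hε).const_mul C
    filter_upwards [htrace.eventually_le_const hc] with n hn
    refine (norm_inner_le_norm (𝕜 := ℂ) (star (u n)) (trace n ψ)).trans (le_trans ?_ hn)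
    gcongr
    exact (norm_Lp_star_le (u n)).trans (hu n)
  obtain ⟨k, hk, w, hw⟩ := hdom.exists_strictMono_tendsto_inner
  refine ⟨k, hk, star w, fun ψ hψ => ?_⟩
  have hlim := inner_star_eq_integral (star w) ((A.gelfandFamily d T).coeFn_evalLp_toLp hψ)
  rw [star_star] at hlim
  refine ((hw hψ.toLp).mono_right (congrArg 𝓝 hlim).le).congr fun n => ?_
  exact inner_star_eq_integral _ ((A.traceFamily T hΦ (ε (k n))).coeFn_evalLp_toLp hψ)

theorem mainTheorem2 (A : AlgebraWithMeanValue) (d : ℕ) (T : ℝ) (hT : 0 < T)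
    (Φ : ℝ → Space d → Space d) (hΦ : IsAdmissibleFlow Φ)
    (ε : ℕ → ℝ) (hε : ∀ n, 0 < ε n) (hε₀ : Tendsto ε atTop (𝓝 0))
    (u : ℕ → Lp ℂ 2 (spaceTimeMeasure d T)) (hu : ∃ C : ℝ, ∀ n, ‖u n‖ ≤ C) :
    ∃ k : ℕ → ℕ, StrictMono k ∧ ∃ u₀ : Lp ℂ 2 (limitMeasure A d T),
      WeaklySigmaConverges A T Φ (ε ∘ k) (u ∘ k) u₀ := by
  obtain ⟨k, hk, u₀, h⟩ := mainTheorem2_general A hΦ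
    (tendsto_nhdsWithin_iff.2 ⟨hε₀, Eventually.of_forall hε⟩) hu.choose_spec
  exact ⟨k, hk, u₀, fun ψ hψ => h ψ hψ.memLp⟩
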